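/- **Setting.** For each security parameter $k\in\mathbb N$ let primes $p,q$ with $\gcd(pq,(p-1)(q-1))=1$ be drawn at random (the theorem holds for every distribution of the pair $(p,q)$, in particular for independently selected primes), where $p,q\ge 2^k$ and the bit lengths of $p,q$ are at most a fixed polynomial in $k$. Let $N=pq$ be the public key. Paillier encryption of $t$ is $E(t;r)=(N+1)^t r^N \bmod N^2$ with $r$ uniform in $\mathbb Z_N^*$. "Polynomial time" means probabilistic algorithms that, on every input and for all coin tosses, halt within a polynomial in $k$ plus the bit length of the input. A function $f:\mathbb N\to\mathbb R_{\ge 0}$ is *negligible* if for every $c\in\mathbb N$ there is $n_c$ with $f(n)\le 1/n^c$ for all $n\ge n_c$. **Decisional Composite Residuosity Assumption.** For every probabilistic polynomial-time algorithm $\mathcal D$, the function $$k\mapsto\bigl|\mathbb P\{\mathcal D(k,N,y^N \bmod N^2)=1\}-\mathbb P\{\mathcal D(k,N,y)=1\}\bigr|$$ is negligible, where $N$ is generated as above and $y$ is uniform in $\mathbb Z_{N^2}^*$. **Security experiment.** Fix $n\in\mathbb N$ and $\mathcal W=\{1,\dots,n\}$. A responder (a pair of probabilistic polynomial-time algorithms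 that share a state) receives $k$ and $N$ and proposes distinct $w_1,w_2\in\mathcal W$. Then $w$ is chosen from $\{w_1,w_2\}$ with equal probability, and the responder receives $x=(x_i)_{i\in\mathcal W}$ with $x_w=E(1;r_w)$ and $x_i=E(0;r_i)$ for $i\ne w$, where the $r_i$ are independent and uniform in $\mathbb Z_N^*$. It outputs a guess $w'\in\{w_1,w_2\}$. Its advantage is $\mathrm{Adv}(k)=|\mathbb P\{w=w'\}-1/2|$. **Proposition.** Under the Decisional Composite Residuosity Assumption, $\mathrm{Adv}$ is negligible for every such responder. -/

import Mathlib

/-! ### Randomized programs with a running time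

The machine model is the random access machine under the logarithmic cost criterion, with
structured control flow: finitely many registers hold natural numbers, arithmetic is charged by
the bit lengths of the operands, and one instruction tosses a fair coin. Registers are unbounded
integers, so that a tape or an array is stored in a register through division and remainder;
the model is polynomially equivalent to probabilistic Turing machines. -/

/-- The contents of the registers. -/
abbrev Store : Type := ℕ → ℕ

/-- The arithmetic instructions of the machine. -/
inductive ArithOp : Type
  | add
  | sub
  | mul
  | div
  | mod

/-- The result of an arithmetic instruction (subtraction is truncated at zero). -/
def ArithOp.apply : ArithOp → ℕ → ℕ → ℕ
  | .add, a, b => a + b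
  | .sub, a, b => a - b
  | .mul, a, b => a * b
  | .div, a, b => a / b
  | .mod, a, b => a % b

/-- Programs. -/
inductive Prog : Type
  /-- store the constant `c` in register `x` -/
  | const (x c : ℕ) : Prog
  /-- store the result of `o`, applied to registers `y` and `z`, in register `x` -/
  | arith (o : ArithOp) (x y z : ℕ) : Prog
  /-- store a fair random bit in register `x` -/
  | coin (x : ℕ) : Prog
  /-- run one program and then the other -/
  | seq (c d : Prog) : Prog
  /-- run `c` if register `x` is nonzero, and `d` otherwise -/
  | ite (x : ℕ) (c d : Prog) : Prog
  /-- run `c` again and again as long as register `x` is nonzero -/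
  | loop (x : ℕ) (c : Prog) : Prog

noncomputable section

/-- The outcome of a computation: `none` if the fuel ran out, and otherwise the final contents of
the registers with the time that was used. -/
abbrev Outcome : Type := Option (Store × ℕ)

/-- Continue a computation with `f`; the times add up. -/
def PMF.andThen (p : PMF Outcome) (f : Store → PMF Outcome) : PMF Outcome :=
  p.bind fun o => match o with
    | none => PMF.pure none
    | some (s, t) => (f s).map (Option.map fun r => (r.1, t + r.2))

/-- A loop with at most `n` tests of its condition; every test costs one time unit. -/
def runLoop (x : ℕ) (body : Store → PMF Outcome) : ℕ → Store → PMF Outcome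
  | 0, _ => PMF.pure none
  | n + 1, s =>
    if s x = 0 then PMF.pure (some (s, 1))
    else ((PMF.pure (some (s, 1))).andThen body).andThen (runLoop x body n)

/-- The distribution of the outcome of a program that is started with registers `s`; `fuel` bounds
the number of tests in each execution of a loop. -/
def Prog.run (fuel : ℕ) : Prog → Store → PMF Outcome
  | .const x c, s => PMF.pure (some (Function.update s x c, c.size + 1))
  | .arith o x y z, s =>
    PMF.pure (some (Function.update s x (o.apply (s y) (s z)), ((s y).size + 1) * ((s z).size + 1)))
  | .coin x, s =>
    (PMF.uniformOfFintype Bool).map fun b => some (Function.update s x b.toNat, 1)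
  | .seq c d, s => (c.run fuel s).andThen (d.run fuel)
  | .ite x c d, s =>
    (PMF.pure (some (s, 1))).andThen (if s x ≠ 0 then c.run fuel else d.run fuel)
  | .loop x c, s => runLoop x (c.run fuel) fuel s

/-- The initial registers: the security parameter `k`, the inputs, and zeros. -/
def loadStore {a : ℕ} (k : ℕ) (v : Fin a → ℕ) : Store
  | 0 => k
  | i + 1 => if h : i < a then v ⟨i, h⟩ else 0

/-- The length of the input, where the security parameter `k` counts as if it were in unary. -/
def inputLength {a : ℕ} (k : ℕ) (v : Fin a → ℕ) : ℕ :=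
  k + ∑ i, ((v i).size + 1)

/-- Probabilistic polynomial-time algorithms with `a` inputs besides the security parameter:
on every input and for every outcome of the coins, the program halts within a number of time units
that is bounded by a polynomial in the length of the input. Since each test of a loop costs a time
unit, fuel equal to the time bound does not restrict the program. -/
structure PPT (a : ℕ) where
  /-- the program -/
  prog : Prog
  /-- the bound on the running time -/
  bound : Polynomial ℕ
  /-- the program halts in time -/
  halts : ∀ (k : ℕ) (v : Fin a → ℕ),
    ∀ o ∈ (prog.run (bound.eval (inputLength k v)) (loadStore k v)).support,
      ∃ (s : Store) (t : ℕ), o = some (s, t) ∧ t ≤ bound.eval (inputLength k v)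

/-- The distribution of the final registers (the default value is never taken). -/
def PPT.exec {a : ℕ} (A : PPT a) (k : ℕ) (v : Fin a → ℕ) : PMF Store :=
  (A.prog.run (A.bound.eval (inputLength k v)) (loadStore k v)).map fun o =>
    (o.map Prod.fst).getD fun _ => 0

/-! ### Paillier encryption -/

/-- The secret primes of the encryption scheme. -/
structure PaillierKey where
  /-- the first prime -/
  p : ℕ
  /-- the second prime -/
  q : ℕ
  prime_p : p.Prime
  prime_q : q.Prime
  gcd_eq_one : Nat.gcd (p * q) ((p - 1) * (q - 1)) = 1

/-- The public key `N = p q`. -/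
def PaillierKey.N (K : PaillierKey) : ℕ := K.p * K.q

theorem PaillierKey.N_ne_zero (K : PaillierKey) : K.N ≠ 0 :=
  Nat.mul_ne_zero K.prime_p.ne_zero K.prime_q.ne_zero

/-- `ℤ_M^*`, the residues in `{0, …, M - 1}` that are coprime to `M`. -/
def unitResidues (M : ℕ) : Finset ℕ := (Finset.range M).filter fun x => Nat.Coprime x M

theorem unitResidues_nonempty {M : ℕ} (hM : M ≠ 0) : (unitResidues M).Nonempty := by
  refine ⟨1 % M, ?_⟩
  simp only [unitResidues, Finset.mem_filter, Finset.mem_range]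
  refine ⟨Nat.mod_lt _ (Nat.pos_of_ne_zero hM), ?_⟩
  have h := Nat.gcd_rec M 1
  rw [Nat.gcd_one_right] at h
  exact h.symm

/-- The encryption `E(t; r) = (N + 1) ^ t * r ^ N mod N ^ 2` of `t` with randomness `r`. -/
def paillierEncrypt (N t r : ℕ) : ℕ := ((N + 1) ^ t * r ^ N) % N ^ 2

/-- Key generation: for every security parameter `k` a distribution of the two primes, which have
more than `k` bits, and a number of bits that is polynomially bounded in `k`. -/
structure KeyGen where
  /-- the distribution of the key for a given security parameter -/
  dist : ℕ → PMF PaillierKey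
  /-- the bound on the bit lengths -/
  bits : Polynomial ℕ
  large : ∀ k, ∀ K ∈ (dist k).support, 2 ^ k ≤ K.p ∧ 2 ^ k ≤ K.q
  bounded : ∀ k, ∀ K ∈ (dist k).support, K.p.size ≤ bits.eval k ∧ K.q.size ≤ bits.eval k

/-! ### Negligible functions and the two security notions -/

/-- A function is negligible if it is eventually below every inverse polynomial. -/
def Negligible (f : ℕ → ℝ) : Prop :=
  ∀ c : ℕ, ∃ n₀ : ℕ, ∀ n : ℕ, n₀ ≤ n → f n ≤ 1 / (n : ℝ) ^ c

/-- A uniformly distributed element of `ℤ_{N²}^*`. -/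
def randomUnit (K : PaillierKey) : PMF ℕ :=
  PMF.uniformOfFinset (unitResidues (K.N ^ 2)) (unitResidues_nonempty (pow_ne_zero 2 K.N_ne_zero))

/-- A uniformly distributed `N`-th residue in `ℤ_{N²}^*`. -/
def randomResidue (K : PaillierKey) : PMF ℕ :=
  (randomUnit K).map fun y => y ^ K.N % K.N ^ 2

/-- The probability that the distinguisher `D` accepts (leaves `1` in register `0`) on the public
key and an element that is drawn from `X`. -/
def acceptProb (G : KeyGen) (X : PaillierKey → PMF ℕ) (D : PPT 2) (k : ℕ) : ℝ :=
  (((G.dist k).bind fun K => (X K).bind fun x => (D.exec k ![K.N, x]).map fun s =>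
    decide (s 0 = 1)) true).toReal

/-- The Decisional Composite Residuosity Assumption: no probabilistic polynomial-time algorithm
can tell a random `N`-th residue modulo `N²` from a random element of `ℤ_{N²}^*` with more than
negligible advantage. -/
def DecisionalCompositeResiduosity (G : KeyGen) : Prop :=
  ∀ D : PPT 2, Negligible fun k =>
    |acceptProb G randomResidue D k - acceptProb G randomUnit D k|

/-- The query for `w` over the index set `{1, …, n}`: the vector whose entry at `w` is a fresh
encryption of `1` and whose other entries are fresh encryptions of `0`. (A uniform element of the
product `(ℤ_N^*)^n` has independent uniform entries; the index `i : Fin n` stands for `i + 1`.) -/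
def submitQuery (n : ℕ) (K : PaillierKey) (w : ℕ) : PMF (Fin n → ℕ) :=
  (PMF.uniformOfFinset (Fintype.piFinset fun _ : Fin n => unitResidues K.N)
    (Fintype.piFinset_nonempty.2 fun _ => unitResidues_nonempty K.N_ne_zero)).map
    fun r i => paillierEncrypt K.N (if (i : ℕ) + 1 = w then 1 else 0) (r i)

/-- An adversary (the responder): `propose` receives the public key and leaves `w₁`, `w₂` and a
state in registers `0`, `1` and `2`; `guess` receives the public key, the state and the query, and
leaves `0` in register `0` for the guess `w₁` and any other number for the guess `w₂`. -/
structure Responder (n : ℕ) where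
  /-- the first phase -/
  propose : PPT 1
  /-- the second phase -/
  guess : PPT (n + 2)

/-- The responder always proposes two different elements of `{1, …, n}`. -/
def Responder.Admissible {n : ℕ} (A : Responder n) (G : KeyGen) : Prop :=
  ∀ k, ∀ K ∈ (G.dist k).support, ∀ s ∈ (A.propose.exec k ![K.N]).support,
    s 0 ∈ Finset.Icc 1 n ∧ s 1 ∈ Finset.Icc 1 n ∧ s 0 ≠ s 1

/-- The security experiment; its value says whether the guess `w'` equals `w`. -/
def guessExperiment {n : ℕ} (G : KeyGen) (A : Responder n) (k : ℕ) : PMF Bool :=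
  (G.dist k).bind fun K =>
  (A.propose.exec k ![K.N]).bind fun s =>
  (PMF.uniformOfFintype Bool).bind fun b =>
  let w := if b then s 1 else s 0
  (submitQuery n K w).bind fun x =>
  (A.guess.exec k (Matrix.vecCons K.N (Matrix.vecCons (s 2) x))).map fun s' =>
  let w' := if s' 0 = 0 then s 0 else s 1
  decide (w' = w)

/-- The advantage `|ℙ(w = w') - 1/2|`. -/
def advantage {n : ℕ} (G : KeyGen) (A : Responder n) (k : ℕ) : ℝ :=
  |(guessExperiment G A k true).toReal - 1 / 2|

/-- The query procedure over `{1, …, n}` is secure and private: every probabilistic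
polynomial-time responder has a negligible advantage. -/
def QuerySecure (n : ℕ) (G : KeyGen) : Prop :=
  ∀ A : Responder n, A.Admissible G → Negligible (advantage G A)

end

/-! ### Running times and outcomes of programs -/

noncomputable section

/-! A responder is turned into a distinguisher for `N`-th residues. Given `(N, y)`, the reduction
lets the responder propose `w₁, w₂`, tosses two coins `b` and `c`, takes `w` to be the proposal
named by `b`, places `z = (cN + 1) y mod N²` at index `w` and fresh `N`-th powers at the other
indices. It accepts if and only if the truth value of "the guess agrees with `b`" equals `c`.

If `y` is a random `N`-th residue, then `z` is a fresh encryption of `c`. For `c = 1` this is the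
security experiment, with acceptance probability `P = ℙ(w = w')`; for `c = 0` the query carries no
information on `b`, and acceptance is a fair coin (`randomResidue_bind_reductionWith`). If `y` is
uniform in `ℤ_{N²}^*`, so is `z`, because `cN + 1` is a unit; the guess is then independent of `c`,
and acceptance is again a fair coin (`randomUnit_bind_reductionWith`). The two acceptance
probabilities differ by `(P - 1/2) / 2`. The coin `c` merges the comparisons of `E(1)` with a
uniform unit and of a uniform unit with `E(0)` into one distinguisher.

Fair coins do not yield exactly uniform units in bounded time. The other entries are therefore
powers `r ^ N` of numbers `r` with as many random digits as `N²` has. Only `r mod N` matters modulo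
`N²`, and it is within `3 / 2 ^ k` of uniform on `ℤ_N^*` (`statClose_smallUnit`); this costs the
term `12 n / 2 ^ k` in `advantage_le`.

It remains to show that the reduction is a polynomial-time program with the intended output law
(`yields_reductionProg`). The predicate `Yields` couples a run with an abstract distribution and
bounds its time, and it composes along the structure of programs. -/

theorem PMF.map_congr_of_support {α β : Type*} {p : PMF α} {f g : α → β}
    (h : ∀ a ∈ p.support, f a = g a) : p.map f = p.map g := by
  ext b
  simp only [PMF.map_apply]
  refine tsum_congr fun a => ?_
  by_cases ha : a ∈ p.support
  · rw [h a ha]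
  · simp [(p.apply_eq_zero_iff a).2 ha]

theorem PMF.bind_congr_of_support {α β : Type*} {p : PMF α} {f g : α → PMF β}
    (h : ∀ a ∈ p.support, f a = g a) : p.bind f = p.bind g := by
  ext b
  simp only [PMF.bind_apply]
  refine tsum_congr fun a => ?_
  by_cases ha : a ∈ p.support
  · rw [h a ha]
  · simp [(p.apply_eq_zero_iff a).2 ha]

@[simp] theorem PMF.pure_some_andThen (s : Store) (t : ℕ) (f : Store → PMF Outcome) :
    (PMF.pure (some (s, t))).andThen f = (f s).map (Option.map fun r => (r.1, t + r.2)) := by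
  simp [PMF.andThen]

theorem PMF.mem_support_andThen {p : PMF Outcome} {f : Store → PMF Outcome} {o : Outcome} :
    o ∈ (p.andThen f).support ↔ (o = none ∧ none ∈ p.support) ∨
      ∃ s t, some (s, t) ∈ p.support ∧ ∃ o' ∈ (f s).support,
        o = Option.map (fun r => (r.1, t + r.2)) o' := by
  rw [PMF.andThen, PMF.mem_support_bind_iff]
  constructor
  · rintro ⟨_ | ⟨s, t⟩, hx, hy⟩
    · left
      exact ⟨by simpa using hy, hx⟩
    · right
      obtain ⟨o', ho', rfl⟩ := (PMF.mem_support_map_iff _ _ _).1 hy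
      exact ⟨s, t, hx, o', ho', rfl⟩
  · rintro (⟨rfl, h⟩ | ⟨s, t, h, o', ho', rfl⟩)
    · exact ⟨none, h, by simp⟩
    · exact ⟨some (s, t), h, (PMF.mem_support_map_iff _ _ _).2 ⟨o', ho', rfl⟩⟩

theorem PMF.none_mem_support_andThen {p : PMF Outcome} {f : Store → PMF Outcome} :
    none ∈ (p.andThen f).support ↔ none ∈ p.support ∨
      ∃ s t, some (s, t) ∈ p.support ∧ none ∈ (f s).support := by
  rw [PMF.mem_support_andThen]
  constructor
  · rintro (⟨-, h⟩ | ⟨s, t, h, o', ho', he⟩)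
    · exact Or.inl h
    · rcases o' with _ | o'
      · exact Or.inr ⟨s, t, h, ho'⟩
      · simp at he
  · rintro (h | ⟨s, t, h, h'⟩)
    · exact Or.inl ⟨rfl, h⟩
    · exact Or.inr ⟨s, t, h, none, h', rfl⟩

/-! ### Independence of the fuel -/

theorem PMF.andThen_congr {p : PMF Outcome} {f g : Store → PMF Outcome}
    (h : ∀ s t, some (s, t) ∈ p.support → f s = g s) : p.andThen f = p.andThen g := by
  refine PMF.bind_congr_of_support fun o ho => ?_
  rcases o with _ | ⟨s, t⟩
  · rfl
  · simp [h s t ho]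

/-- Exhaustion of the fuel is never undone by a continuation. If the composite cannot run out,
neither can the first part, nor the second part on any store that is reached. -/
theorem PMF.andThen_mono {p p' : PMF Outcome} {f g : Store → PMF Outcome}
    (hn : none ∉ (p.andThen f).support) (hp : none ∉ p.support → p' = p)
    (hf : ∀ s, none ∉ (f s).support → g s = f s) : p'.andThen g = p.andThen f := by
  rw [PMF.none_mem_support_andThen] at hn
  push Not at hn
  rw [hp hn.1]
  exact PMF.andThen_congr fun s t hs => hf s (hn.2 s t hs)

theorem runLoop_mono {x : ℕ} {b b' : Store → PMF Outcome}
    (hb : ∀ s, none ∉ (b s).support → b' s = b s) {n m : ℕ} (hnm : n ≤ m) (s : Store)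
    (hs : none ∉ (runLoop x b n s).support) : runLoop x b' m s = runLoop x b n s := by
  induction n generalizing m s with
  | zero => simp [runLoop] at hs
  | succ n ih =>
    obtain ⟨m, rfl⟩ := Nat.exists_eq_add_of_le' (Nat.one_le_of_lt hnm)
    rw [runLoop] at hs ⊢
    rw [runLoop]
    split_ifs with h0
    · rfl
    · rw [if_neg h0] at hs
      refine PMF.andThen_mono hs (fun h1 => ?_) (fun s' h' => ih (by omega) s' h')
      exact PMF.andThen_mono h1 (fun _ => rfl) hb

/-- More fuel does not change a computation that did not run out of fuel. -/
theorem Prog.run_mono (P : Prog) {n m : ℕ} (hnm : n ≤ m) (s : Store)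
    (hs : none ∉ (P.run n s).support) : P.run m s = P.run n s := by
  induction P generalizing s with
  | const => rfl
  | arith => rfl
  | coin => rfl
  | seq c d hc hd =>
    rw [Prog.run] at hs ⊢
    rw [Prog.run]
    exact PMF.andThen_mono hs (hc s) hd
  | ite x c d hc hd =>
    rw [Prog.run] at hs ⊢
    rw [Prog.run]
    refine PMF.andThen_mono hs (fun _ => rfl) fun s' h' => ?_
    split_ifs with h0
    · rw [if_pos h0] at h'
      exact hc s' h'
    · rw [if_neg h0] at h'
      exact hd s' h'
  | loop x c hc =>
    rw [Prog.run] at hs ⊢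
    rw [Prog.run]
    exact runLoop_mono hc hnm s hs

/-- Computations that cannot leave a register longer than the maximum of its initial length and
the elapsed time. -/
def SizeControlled (f : Store → PMF Outcome) : Prop :=
  ∀ s s' t, some (s', t) ∈ (f s).support → ∀ i, (s' i).size ≤ max (s i).size t

theorem SizeControlled.andThen {f g : Store → PMF Outcome} (hf : SizeControlled f)
    (hg : SizeControlled g) : SizeControlled fun s => (f s).andThen g := by
  intro s s' t h i
  rw [PMF.mem_support_andThen] at h
  obtain ⟨h, -⟩ | ⟨s₁, t₁, h₁, o', ho', he⟩ := h
  · simp at h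
  · rcases o' with _ | ⟨s₂, t₂⟩
    · simp at he
    · simp only [Option.map_some, Option.some.injEq, Prod.mk.injEq] at he
      obtain ⟨rfl, rfl⟩ := he
      have h1 := hf s s₁ t₁ h₁ i
      have h2 := hg s₁ s' t₂ ho' i
      omega

theorem sizeControlled_tick : SizeControlled fun s => PMF.pure (some (s, 1)) := by
  intro s s' t h i
  simp at h
  simp [h.1]

theorem SizeControlled.runLoop {x : ℕ} {b : Store → PMF Outcome} (hb : SizeControlled b) (n : ℕ) :
    SizeControlled (runLoop x b n) := by
  induction n with
  | zero => intro s s' t h; simp [_root_.runLoop] at h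
  | succ n ih =>
    intro s s' t h i
    rw [_root_.runLoop] at h
    split_ifs at h
    · exact sizeControlled_tick s s' t h i
    · exact ((sizeControlled_tick.andThen hb).andThen ih) s s' t h i

theorem Nat.size_add_le (a b : ℕ) : (a + b).size ≤ max a.size b.size + 1 := by
  rw [Nat.size_le, pow_succ]
  have ha := a.lt_size_self
  have hb := b.lt_size_self
  have h1 : 2 ^ a.size ≤ 2 ^ max a.size b.size := Nat.pow_le_pow_right (by norm_num) (by simp)
  have h2 : 2 ^ b.size ≤ 2 ^ max a.size b.size := Nat.pow_le_pow_right (by norm_num) (by simp)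
  omega

theorem Nat.size_mul_le (a b : ℕ) : (a * b).size ≤ a.size + b.size := by
  rw [Nat.size_le, pow_add]
  exact Nat.mul_lt_mul'' a.lt_size_self b.lt_size_self

/-- The logarithmic cost of an instruction dominates the length of its result. Running time
therefore controls the growth of the registers, which `Prog.sizeControlled` propagates to all
programs. -/
theorem ArithOp.size_apply_le (o : ArithOp) (a b : ℕ) :
    (o.apply a b).size ≤ (a.size + 1) * (b.size + 1) := by
  have h : a.size ≤ (a.size + 1) * (b.size + 1) := by nlinarith [Nat.zero_le (a.size * b.size)]
  cases o with
  | add =>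
    refine (Nat.size_add_le a b).trans ?_
    have h2 : b.size ≤ (a.size + 1) * (b.size + 1) := by
      nlinarith [Nat.zero_le (a.size * b.size)]
    rcases max_cases a.size b.size with h | h <;> rw [h.1] <;>
      nlinarith [Nat.zero_le (a.size * b.size)]
  | sub => exact (Nat.size_le_size (Nat.sub_le a b)).trans h
  | mul =>
    refine (Nat.size_mul_le a b).trans ?_
    nlinarith [Nat.zero_le (a.size * b.size)]
  | div => exact (Nat.size_le_size (Nat.div_le_self a b)).trans h
  | mod => exact (Nat.size_le_size (Nat.mod_le a b)).trans h

theorem Store.size_update_le {s : Store} {x v t : ℕ} (h : v.size ≤ t) (i : ℕ) :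
    (Function.update s x v i).size ≤ max (s i).size t := by
  by_cases hi : i = x
  · subst hi
    simp [h]
  · simp [hi]

theorem Prog.sizeControlled (P : Prog) (fuel : ℕ) : SizeControlled (P.run fuel) := by
  induction P with
  | const x c =>
    intro s s' t h i
    simp only [Prog.run, PMF.mem_support_pure_iff, Option.some.injEq, Prod.mk.injEq] at h
    obtain ⟨rfl, rfl⟩ := h
    exact Store.size_update_le (by omega) i
  | arith o x y z =>
    intro s s' t h i
    simp only [Prog.run, PMF.mem_support_pure_iff, Option.some.injEq, Prod.mk.injEq] at h
    obtain ⟨rfl, rfl⟩ := h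
    exact Store.size_update_le (o.size_apply_le _ _) i
  | coin x =>
    intro s s' t h i
    obtain ⟨b, -, hb⟩ := (PMF.mem_support_map_iff _ _ _).1 h
    simp only [Option.some.injEq, Prod.mk.injEq] at hb
    obtain ⟨rfl, rfl⟩ := hb
    exact Store.size_update_le (by cases b <;> simp) i
  | seq c d hc hd => exact hc.andThen hd
  | ite x c d hc hd =>
    intro s
    by_cases h0 : s x ≠ 0
    · have := (sizeControlled_tick.andThen hc) s
      simpa [Prog.run, h0] using this
    · have := (sizeControlled_tick.andThen hd) s
      simpa [Prog.run, h0] using this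
  | loop x c hc => exact hc.runLoop fuel

/-- The program in which register `i` is replaced by register `φ i`. -/
def Prog.rename (φ : ℕ → ℕ) : Prog → Prog
  | .const x c => .const (φ x) c
  | .arith o x y z => .arith o (φ x) (φ y) (φ z)
  | .coin x => .coin (φ x)
  | .seq c d => .seq (c.rename φ) (d.rename φ)
  | .ite x c d => .ite (φ x) (c.rename φ) (d.rename φ)
  | .loop x c => .loop (φ x) (c.rename φ)

/-- The effect of a renamed computation on an outcome. -/
def Outcome.extend (φ : ℕ → ℕ) (u : Store) : Outcome → Outcome :=
  Option.map fun r => (Function.extend φ r.1 u, r.2)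

/-! ### Renaming of registers -/

theorem Store.extend_update {φ : ℕ → ℕ} (hφ : φ.Injective) (s u : Store) (x v : ℕ) :
    Function.extend φ (Function.update s x v) u =
      Function.update (Function.extend φ s u) (φ x) v := by
  funext i
  by_cases hi : ∃ j, φ j = i
  · obtain ⟨j, rfl⟩ := hi
    rw [hφ.extend_apply]
    by_cases hj : j = x
    · subst hj; simp
    · rw [Function.update_of_ne hj, Function.update_of_ne (hφ.ne hj), hφ.extend_apply]
  · rw [Function.extend_apply' _ _ _ hi, Function.update_of_ne, Function.extend_apply' _ _ _ hi]
    rintro rfl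
    exact hi ⟨x, rfl⟩

theorem PMF.map_extend_andThen {φ : ℕ → ℕ} {u : Store} {p p' : PMF Outcome}
    {f g : Store → PMF Outcome} (hp : p' = p.map (Outcome.extend φ u))
    (hf : ∀ s, g (Function.extend φ s u) = (f s).map (Outcome.extend φ u)) :
    p'.andThen g = (p.andThen f).map (Outcome.extend φ u) := by
  rw [hp, PMF.andThen, PMF.andThen, PMF.bind_map, PMF.map_bind]
  congr 1
  funext o
  rcases o with _ | ⟨s, t⟩
  · simp [Outcome.extend, PMF.pure_map]
  · simp only [Function.comp, Outcome.extend, Option.map_some, hf, PMF.map_comp]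
    congr 1
    funext o
    cases o <;> rfl

theorem runLoop_rename {φ : ℕ → ℕ} (hφ : φ.Injective) {u : Store} {x : ℕ}
    {b b' : Store → PMF Outcome}
    (hb : ∀ s, b' (Function.extend φ s u) = (b s).map (Outcome.extend φ u)) (n : ℕ) (s : Store) :
    runLoop (φ x) b' n (Function.extend φ s u) = (runLoop x b n s).map (Outcome.extend φ u) := by
  induction n generalizing s with
  | zero => simp [runLoop, PMF.pure_map, Outcome.extend]
  | succ n ih =>
    rw [runLoop, runLoop, hφ.extend_apply]
    split_ifs with h0
    · simp [PMF.pure_map, Outcome.extend]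
    · refine PMF.map_extend_andThen (PMF.map_extend_andThen ?_ hb) ih
      simp [PMF.pure_map, Outcome.extend]

/-- With `φ` injective no two registers collide, so a program can run inside a larger one, on
registers of its own, while the remaining registers keep the contents `u`. Both phases of the
responder are embedded in the reduction in this way. -/
theorem Prog.run_rename {φ : ℕ → ℕ} (hφ : φ.Injective) (P : Prog) (fuel : ℕ) (s u : Store) :
    (P.rename φ).run fuel (Function.extend φ s u) =
      (P.run fuel s).map (Outcome.extend φ u) := by
  induction P generalizing s with
  | const x c => simp [Prog.rename, Prog.run, PMF.pure_map, Outcome.extend, Store.extend_update hφ]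
  | arith o x y z =>
    simp [Prog.rename, Prog.run, PMF.pure_map, Outcome.extend, Store.extend_update hφ,
      hφ.extend_apply]
  | coin x =>
    simp [Prog.rename, Prog.run, PMF.map_comp, Function.comp_def, Outcome.extend,
      Store.extend_update hφ]
  | seq c d hc hd => exact PMF.map_extend_andThen (hc s) hd
  | ite x c d hc hd =>
    rw [Prog.rename, Prog.run, Prog.run, hφ.extend_apply]
    refine PMF.map_extend_andThen (by simp [PMF.pure_map, Outcome.extend]) fun s' => ?_
    split_ifs
    · exact hc s'
    · exact hd s'
  | loop x c hc => exact runLoop_rename hφ hc fuel s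

end

noncomputable section

/-! ### A calculus for the behaviour of programs -/

/-- Started with registers `s`, the program `P` halts within `T` time units for all outcomes of
its coins, and its run can be coupled with a value of distribution `d` such that the value and the
final registers satisfy `Q`. -/
def Yields {α : Type*} (P : Prog) (s : Store) (T : ℕ) (d : PMF α) (Q : α → Store → Prop) : Prop :=
  ∀ fuel, T ≤ fuel → ∃ p : PMF (α × Store × ℕ), p.map Prod.fst = d ∧
    p.map (fun x => some x.2) = P.run fuel s ∧ ∀ x ∈ p.support, Q x.1 x.2.1 ∧ x.2.2 ≤ T

section

variable {α β : Type*} {P P' : Prog} {s : Store} {T T' : ℕ} {d : PMF α} {Q Q' : α → Store → Prop}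

theorem Yields.mono (h : Yields P s T d Q) (hT : T ≤ T')
    (hQ : ∀ a ∈ d.support, ∀ s', Q a s' → Q' a s') : Yields P s T' d Q' := by
  intro fuel hf
  obtain ⟨p, hp, hr, hs⟩ := h fuel (hT.trans hf)
  refine ⟨p, hp, hr, fun x hx => ⟨hQ _ ?_ _ (hs x hx).1, (hs x hx).2.trans hT⟩⟩
  rw [← hp]
  exact (PMF.mem_support_map_iff _ _ _).2 ⟨x, hx, rfl⟩

theorem Yields.map {R : β → Store → Prop} (h : Yields P s T d Q) (f : α → β)
    (hR : ∀ a ∈ d.support, ∀ s', Q a s' → R (f a) s') : Yields P s T (d.map f) R := by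
  intro fuel hf
  obtain ⟨p, hp, hr, hs⟩ := h fuel hf
  refine ⟨p.map fun x => (f x.1, x.2), ?_, ?_, ?_⟩
  · rw [← hp, PMF.map_comp, PMF.map_comp]; rfl
  · rw [← hr, PMF.map_comp]; rfl
  · intro x hx
    obtain ⟨y, hy, rfl⟩ := (PMF.mem_support_map_iff _ _ _).1 hx
    refine ⟨hR _ ?_ _ (hs y hy).1, (hs y hy).2⟩
    rw [← hp]
    exact (PMF.mem_support_map_iff _ _ _).2 ⟨y, hy, rfl⟩

theorem Yields.of_run_eq_pure {a : α} {s' : Store} {t : ℕ}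
    (h : ∀ fuel, P.run fuel s = PMF.pure (some (s', t))) (ht : t ≤ T) (hQ : Q a s') :
    Yields P s T (PMF.pure a) Q := by
  intro fuel _
  refine ⟨PMF.pure (a, s', t), by simp [PMF.pure_map], by simp [PMF.pure_map, h], ?_⟩
  intro x hx
  obtain rfl := (PMF.mem_support_pure_iff _ _).1 hx
  exact ⟨hQ, ht⟩

/-- Couplings compose: draw from the first coupling, then from a coupling of the continuation that
depends on the drawn value and store, and add the times. -/
theorem exists_coupling_andThen {e : α → PMF β} {R : β → Store → Prop} {r : PMF Outcome}
    {f : Store → PMF Outcome}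
    (h : ∃ p : PMF (α × Store × ℕ), p.map Prod.fst = d ∧ p.map (fun x => some x.2) = r ∧
      ∀ x ∈ p.support, Q x.1 x.2.1 ∧ x.2.2 ≤ T)
    (h' : ∀ a ∈ d.support, ∀ s', Q a s' → ∃ p : PMF (β × Store × ℕ), p.map Prod.fst = e a ∧
      p.map (fun x => some x.2) = f s' ∧ ∀ x ∈ p.support, R x.1 x.2.1 ∧ x.2.2 ≤ T') :
    ∃ p : PMF (β × Store × ℕ), p.map Prod.fst = d.bind e ∧
      p.map (fun x => some x.2) = r.andThen f ∧ ∀ x ∈ p.support, R x.1 x.2.1 ∧ x.2.2 ≤ T + T' := by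
  classical
  obtain ⟨p, rfl, rfl, hs⟩ := h
  -- A coupling must be chosen for every triple. Outside the support its properties are irrelevant,
  -- and one that belongs to some point of the support is reused.
  have hex : ∀ x : α × Store × ℕ, ∃ q : PMF (β × Store × ℕ), x ∈ p.support →
      q.map Prod.fst = e x.1 ∧ q.map (fun x => some x.2) = f x.2.1 ∧
      ∀ y ∈ q.support, R y.1 y.2.1 ∧ y.2.2 ≤ T' := by
    intro x
    by_cases hx : x ∈ p.support
    · obtain ⟨q, hq⟩ := h' x.1 ((PMF.mem_support_map_iff _ _ _).2 ⟨x, hx, rfl⟩) x.2.1 (hs x hx).1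
      exact ⟨q, fun _ => hq⟩
    · obtain ⟨y, hy⟩ := p.support_nonempty
      obtain ⟨q, -⟩ := h' y.1 ((PMF.mem_support_map_iff _ _ _).2 ⟨y, hy, rfl⟩) y.2.1 (hs y hy).1
      exact ⟨q, fun h => absurd h hx⟩
  choose q hq using hex
  refine ⟨p.bind fun x => (q x).map fun y => (y.1, y.2.1, x.2.2 + y.2.2), ?_, ?_, ?_⟩
  · rw [PMF.map_bind, PMF.bind_map]
    refine PMF.bind_congr_of_support fun x hx => ?_
    rw [PMF.map_comp, Function.comp_apply, ← (hq x hx).1]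
    rfl
  · rw [PMF.map_bind, PMF.andThen, PMF.bind_map]
    refine PMF.bind_congr_of_support fun x hx => ?_
    rw [PMF.map_comp, Function.comp_apply]
    simp only
    rw [← (hq x hx).2.1, PMF.map_comp]
    rfl
  · intro z hz
    obtain ⟨x, hx, hz⟩ := (PMF.mem_support_bind_iff _ _ _).1 hz
    obtain ⟨y, hy, rfl⟩ := (PMF.mem_support_map_iff _ _ _).1 hz
    exact ⟨((hq x hx).2.2 y hy).1, Nat.add_le_add (hs x hx).2 ((hq x hx).2.2 y hy).2⟩

theorem Yields.seq {e : α → PMF β} {R : β → Store → Prop} (h : Yields P s T d Q)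
    (h' : ∀ a ∈ d.support, ∀ s', Q a s' → Yields P' s' T' (e a) R) :
    Yields (P.seq P') s (T + T') (d.bind e) R := fun fuel hf =>
  exists_coupling_andThen (h fuel (by omega)) fun a ha s' hs' => h' a ha s' hs' fuel (by omega)

theorem Yields.seq_pure {a : α} {d : PMF β} {R : β → Store → Prop}
    (h : Yields P s T (PMF.pure a) Q)
    (h' : ∀ s', Q a s' → Yields P' s' T' d R) : Yields (P.seq P') s (T + T') d R := by
  have := Yields.seq (e := fun _ => d) (R := R) (T' := T') (P' := P') h fun b hb s' hs' => by
    obtain rfl := (PMF.mem_support_pure_iff _ _).1 hb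
    exact h' s' hs'
  simpa using this

theorem Yields.seq_map {R : β → Store → Prop} {f : α → β} (h : Yields P s T d Q)
    (h' : ∀ a ∈ d.support, ∀ s', Q a s' → Yields P' s' T' (PMF.pure (f a)) R) :
    Yields (P.seq P') s (T + T') (d.map f) R := Yields.seq h h'

theorem yields_tick : ∃ p : PMF (Unit × Store × ℕ), p.map Prod.fst = PMF.pure () ∧
      p.map (fun x => some x.2) = PMF.pure (some (s, 1)) ∧
      ∀ x ∈ p.support, x.2.1 = s ∧ x.2.2 ≤ 1 :=
  ⟨PMF.pure ((), s, 1), by simp [PMF.pure_map], by simp [PMF.pure_map], by simp⟩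

theorem Yields.ite {x : ℕ} (h : s x ≠ 0 → Yields P s T d Q) (h' : s x = 0 → Yields P' s T d Q) :
    Yields (.ite x P P') s (T + 1) d Q := by
  intro fuel hf
  rw [Prog.run, add_comm]
  have := exists_coupling_andThen (d := PMF.pure ()) (Q := fun _ s' => s' = s)
        (T := 1) (e := fun _ => d) (R := Q) (T' := T)
    (f := if s x ≠ 0 then P.run fuel else P'.run fuel) (yields_tick (s := s)) ?_
  · simpa using this
  · rintro - - s' rfl
    split_ifs with h0
    · exact h h0 fuel (by omega)
    · exact h' (not_not.1 h0) fuel (by omega)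

theorem yields_const {x c : ℕ} (a : α) :
    Yields (.const x c) s (c.size + 1) (PMF.pure a) fun _ s' => s' = Function.update s x c :=
  .of_run_eq_pure (fun _ => rfl) le_rfl rfl

theorem yields_arith {o : ArithOp} {x y z : ℕ} (a : α) :
    Yields (.arith o x y z) s (((s y).size + 1) * ((s z).size + 1)) (PMF.pure a)
      fun _ s' => s' = Function.update s x (o.apply (s y) (s z)) :=
  .of_run_eq_pure (fun _ => rfl) le_rfl rfl

theorem yields_coin {x : ℕ} :
    Yields (.coin x) s 1 (PMF.uniformOfFintype Bool)
      fun b s' => s' = Function.update s x b.toNat := by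
  intro fuel _
  refine ⟨(PMF.uniformOfFintype Bool).map fun b => (b, Function.update s x b.toNat, 1), ?_, ?_, ?_⟩
  · rw [PMF.map_comp]
    exact PMF.map_id _
  · rw [PMF.map_comp]
    rfl
  · intro x hx
    obtain ⟨b, -, rfl⟩ := (PMF.mem_support_map_iff _ _ _).1 hx
    exact ⟨rfl, le_rfl⟩

theorem Yields.none_notMem (h : Yields P s T d Q) {fuel : ℕ} (hf : T ≤ fuel) :
    none ∉ (P.run fuel s).support := by
  obtain ⟨p, -, hr, -⟩ := h fuel hf
  rw [← hr, PMF.mem_support_map_iff]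
  rintro ⟨x, -, hx⟩
  simp at hx

theorem Yields.loop_zero {x : ℕ} {a : α} (h0 : s x = 0) (hQ : Q a s) :
    Yields (.loop x P) s 1 (PMF.pure a) Q := by
  intro fuel hf
  obtain ⟨n, rfl⟩ := Nat.exists_eq_add_of_le' hf
  refine ⟨PMF.pure (a, s, 1), by simp [PMF.pure_map], ?_, by simp [hQ]⟩
  simp [Prog.run, runLoop, h0, PMF.pure_map]

theorem Yields.loop_step {x : ℕ} {e : α → PMF β} {R : β → Store → Prop} (h0 : s x ≠ 0)
    (h : Yields P s T d Q)
    (h' : ∀ a ∈ d.support, ∀ s', Q a s' → Yields (.loop x P) s' T' (e a) R) :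
    Yields (.loop x P) s (1 + T + T') (d.bind e) R := by
  intro fuel hf
  obtain ⟨n, rfl⟩ := Nat.exists_eq_add_of_le' (show 1 ≤ fuel by omega)
  rw [Prog.run, runLoop, if_neg h0]
  refine exists_coupling_andThen (d := d) (Q := Q) ?_ ?_
  · have := exists_coupling_andThen (d := PMF.pure ()) (Q := fun _ s' => s' = s)
        (T := 1) (e := fun _ => d) (R := Q) (T' := T)
      (f := P.run (n + 1)) (yields_tick (s := s)) ?_
    · simpa using this
    · rintro - - s' rfl
      exact h (n + 1) (by omega)
  · intro a ha s' hs'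
    have hy := h' a ha s' hs'
    have hn := hy.none_notMem (show T' ≤ n by omega)
    -- After one iteration `n` tests remain, but the body still runs with fuel `n + 1`. The
    -- induction hypothesis gives both of them `n`, which already suffices, so more fuel in the body
    -- changes nothing.
    have he : runLoop x (P.run (n + 1)) n s' = (Prog.loop x P).run n s' :=
      runLoop_mono (fun s hs => P.run_mono (Nat.le_succ n) s hs) le_rfl s' hn
    rw [he]
    exact hy n (by omega)

end

/-! ### Algorithms within the calculus -/

theorem PPT.run_eq {a : ℕ} (A : PPT a) (k : ℕ) (v : Fin a → ℕ) {fuel : ℕ}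
    (hf : A.bound.eval (inputLength k v) ≤ fuel) :
    A.prog.run fuel (loadStore k v) =
      A.prog.run (A.bound.eval (inputLength k v)) (loadStore k v) := by
  refine A.prog.run_mono hf _ fun h => ?_
  obtain ⟨s, t, h, -⟩ := A.halts k v _ h
  simp at h

/-- An algorithm is coupled with its own final registers. The length bound is what keeps the state
that the first phase hands over polynomially long. -/
theorem PPT.yields {a : ℕ} (A : PPT a) (k : ℕ) (v : Fin a → ℕ) :
    Yields A.prog (loadStore k v) (A.bound.eval (inputLength k v)) (A.exec k v) fun s' s'' =>
      s'' = s' ∧ ∀ i, (s' i).size ≤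
        max (loadStore k v i).size (A.bound.eval (inputLength k v)) := by
  intro fuel hf
  rw [A.run_eq k v hf]
  set f : Outcome → Store := fun o => (o.map Prod.fst).getD fun _ => 0
  set g : Outcome → ℕ := fun o => (o.map Prod.snd).getD 0
  refine ⟨(A.prog.run (A.bound.eval (inputLength k v)) (loadStore k v)).map
    fun o => (f o, f o, g o), ?_, ?_, ?_⟩
  · rw [PMF.map_comp]; rfl
  · rw [PMF.map_comp]
    conv_rhs => rw [← PMF.map_id (A.prog.run _ _)]
    refine PMF.map_congr_of_support fun o ho => ?_
    obtain ⟨s, t, rfl, -⟩ := A.halts k v o ho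
    rfl
  · intro x hx
    obtain ⟨o, ho, rfl⟩ := (PMF.mem_support_map_iff _ _ _).1 hx
    obtain ⟨s, t, rfl, ht⟩ := A.halts k v o ho
    refine ⟨⟨rfl, fun i => ?_⟩, ht⟩
    exact (A.prog.sizeControlled _ _ _ _ ho i).trans (max_le_max le_rfl ht)

theorem Yields.rename {α : Type*} {φ : ℕ → ℕ} (hφ : φ.Injective) {P : Prog} {s u : Store} {T : ℕ}
    {d : PMF α} {Q : α → Store → Prop} (h : Yields P s T d Q) (hu : ∀ i, u (φ i) = s i) :
    Yields (P.rename φ) u T d fun a s' =>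
      Q a (fun i => s' (φ i)) ∧ ∀ i, i ∉ Set.range φ → s' i = u i := by
  intro fuel hf
  obtain ⟨p, hp, hr, hs⟩ := h fuel hf
  have hu' : u = Function.extend φ s u := by
    funext i
    by_cases hi : ∃ j, φ j = i
    · obtain ⟨j, rfl⟩ := hi
      rw [hφ.extend_apply, hu]
    · rw [Function.extend_apply' _ _ _ hi]
  refine ⟨p.map fun x => (x.1, Function.extend φ x.2.1 u, x.2.2), ?_, ?_, ?_⟩
  · rw [← hp, PMF.map_comp]; rfl
  · conv_rhs => rw [hu', P.run_rename hφ, ← hr, PMF.map_comp]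
    rw [PMF.map_comp]; rfl
  · intro x hx
    obtain ⟨y, hy, rfl⟩ := (PMF.mem_support_map_iff _ _ _).1 hx
    refine ⟨⟨?_, fun i hi => Function.extend_apply' _ _ _ hi⟩, (hs y hy).2⟩
    simpa [hφ.extend_apply] using (hs y hy).1

/-- A program that halts within a polynomial in the length of the input is an algorithm. -/
def PPT.ofYields {a : ℕ} {α : (k : ℕ) → (Fin a → ℕ) → Type} (P : Prog) (b : Polynomial ℕ)
    (d : ∀ k v, PMF (α k v)) (Q : ∀ k v, α k v → Store → Prop)
    (h : ∀ k v, Yields P (loadStore k v) (b.eval (inputLength k v)) (d k v) (Q k v)) : PPT a where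
  prog := P
  bound := b
  halts k v o ho := by
    obtain ⟨p, -, hr, hs⟩ := h k v _ le_rfl
    rw [← hr] at ho
    obtain ⟨x, hx, rfl⟩ := (PMF.mem_support_map_iff _ _ _).1 ho
    exact ⟨_, _, rfl, (hs x hx).2⟩

theorem Yields.exec_map {a : ℕ} {α : Type} {A : PPT a} {k : ℕ} {v : Fin a → ℕ} {d : PMF α}
    {f : Store → α} (h : Yields A.prog (loadStore k v) (A.bound.eval (inputLength k v)) d
      fun x s => f s = x) : (A.exec k v).map f = d := by
  obtain ⟨p, hp, hr, hs⟩ := h _ le_rfl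
  rw [PPT.exec, ← hr, PMF.map_comp, PMF.map_comp, ← hp]
  exact PMF.map_congr_of_support fun x hx => (hs x hx).1

end

noncomputable section

/-! ### Deterministic programs without loops -/

/-- The program neither tosses coins nor contains loops. -/
def Prog.Straight : Prog → Prop
  | .const _ _ => True
  | .arith _ _ _ _ => True
  | .coin _ => False
  | .seq c d => c.Straight ∧ d.Straight
  | .ite _ c d => c.Straight ∧ d.Straight
  | .loop _ _ => False

/-- The final registers of a deterministic program without loops. -/
def Prog.result : Prog → Store → Store
  | .const x c, s => Function.update s x c
  | .arith o x y z, s => Function.update s x (o.apply (s y) (s z))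
  | .coin _, s => s
  | .seq c d, s => d.result (c.result s)
  | .ite x c d, s => if s x = 0 then d.result s else c.result s
  | .loop _ _, s => s

/-- The running time of a deterministic program without loops. -/
def Prog.time : Prog → Store → ℕ
  | .const _ c, _ => c.size + 1
  | .arith _ _ y z, s => ((s y).size + 1) * ((s z).size + 1)
  | .coin _, _ => 0
  | .seq c d, s => c.time s + d.time (c.result s)
  | .ite x c d, s => 1 + if s x = 0 then d.time s else c.time s
  | .loop _ _, _ => 0

theorem Prog.run_eq_of_straight {P : Prog} (h : P.Straight) (fuel : ℕ) (s : Store) :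
    P.run fuel s = PMF.pure (some (P.result s, P.time s)) := by
  induction P generalizing s with
  | const => rfl
  | arith => rfl
  | coin => exact h.elim
  | loop => exact h.elim
  | seq c d hc hd =>
    rw [Prog.run, hc h.1, PMF.pure_some_andThen, hd h.2, PMF.pure_map]
    rfl
  | ite x c d hc hd =>
    rw [Prog.run, PMF.pure_some_andThen]
    by_cases h0 : s x = 0
    · simp [h0, hd h.2, PMF.pure_map, Prog.result, Prog.time]
    · simp [h0, hc h.1, PMF.pure_map, Prog.result, Prog.time]

theorem Prog.Straight.yields {α : Type*} {P : Prog} (h : P.Straight) (s : Store) {T : ℕ}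
    (hT : P.time s ≤ T) (a : α) : Yields P s T (PMF.pure a) fun _ s' => s' = P.result s :=
  .of_run_eq_pure (fun fuel => P.run_eq_of_straight h fuel s) hT rfl

/-- Halving removes exactly one binary digit, so the length of register `11` counts the iterations
of both loops below. -/
theorem Nat.size_div_two {t : ℕ} (ht : t ≠ 0) : (t / 2).size + 1 = t.size := by
  apply le_antisymm
  · rw [Nat.add_one_le_iff, Nat.lt_size]
    rcases Nat.eq_zero_or_pos (t / 2) with h | h
    · rw [h, Nat.size_zero, pow_zero]; omega
    · have h1 : 2 ^ ((t / 2).size - 1) ≤ t / 2 := Nat.lt_size.1 (by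
        have := Nat.size_pos.2 h; omega)
      have h2 : (t / 2).size = (t / 2).size - 1 + 1 := by have := Nat.size_pos.2 h; omega
      rw [h2, pow_succ]
      omega
  · rw [Nat.size_le, pow_succ]
    have := (t / 2).lt_size_self
    omega

theorem Nat.size_two : Nat.size 2 = 2 := by
  simpa using Nat.size_pow (n := 1)

theorem Nat.size_le_self (n : ℕ) : n.size ≤ n := Nat.size_le.2 Nat.lt_two_pow_self

/-! ### Sampling random bits -/

/-- The number that arises from `a` by appending `m` random binary digits. -/
def randomBits : ℕ → ℕ → PMF ℕ
  | 0, a => PMF.pure a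
  | m + 1, a => (PMF.uniformOfFintype Bool).bind fun b => randomBits m (a + a + b.toNat)

/-- Append a random digit to register `12` and remove a digit from register `11`. -/
def bitStep : Prog :=
  .seq (.arith .div 11 11 10) (.seq (.coin 14) (.seq (.arith .add 12 12 12) (.arith .add 12 12 14)))

theorem yields_bitStep {s : Store} {S : ℕ} (h10 : s 10 = 2) (h11 : (s 11).size ≤ S)
    (h12 : (s 12).size + 1 ≤ S) :
    Yields bitStep s (8 * (S + 1) ^ 2) (PMF.uniformOfFintype Bool) fun b s' =>
      s' 11 = s 11 / 2 ∧ s' 12 = s 12 + s 12 + b.toNat ∧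
        ∀ i, i ≤ 10 ∨ 15 ≤ i → s' i = s i := by
  -- The calculus produces a sum of instruction costs and a `bind` with `PMF.pure`; both are
  -- simplified afterwards. The factor `3` is the cost factor of the operand `2`, whose length is
  -- `2`.
  have key : Yields bitStep s (3 * (S + 1) + (1 + ((S + 1) ^ 2 + (S + 1) * 2)))
      ((PMF.uniformOfFintype Bool).bind PMF.pure) fun b s' =>
      s' 11 = s 11 / 2 ∧ s' 12 = s 12 + s 12 + b.toNat ∧
        ∀ i, i ≤ 10 ∨ 15 ≤ i → s' i = s i := by
    refine Yields.seq_pure ((yields_arith ()).mono ?_ fun _ _ _ h => h) ?_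
    · rw [h10, Nat.size_two]; nlinarith
    rintro _ rfl
    refine Yields.seq yields_coin ?_
    rintro b - _ rfl
    have hb : b.toNat.size ≤ 1 := by cases b <;> simp
    have ha : (s 12 + s 12).size ≤ S := (Nat.size_add_le _ _).trans (by simpa using h12)
    refine Yields.mono (Prog.Straight.yields ?_ _ le_rfl _) ?_ ?_
    · simp [Prog.Straight]
    · simp only [Prog.time, Prog.result, Function.update_apply, ArithOp.apply]
      norm_num
      have h12' : (s 12).size ≤ S := by omega
      rw [pow_two]
      gcongr
      omega
    · rintro a ha' _ rfl
      obtain rfl := (PMF.mem_support_pure_iff _ _).1 ha'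
      refine ⟨by simp [Prog.result, h10, ArithOp.apply], by simp [Prog.result, ArithOp.apply], ?_⟩
      intro i hi
      simp only [Prog.result]
      repeat rw [Function.update_of_ne (by omega)]
  rw [PMF.bind_pure] at key
  refine key.mono ?_ fun _ _ _ h => h
  nlinarith

/-- Only the length of the counter in register `11` matters. Each iteration shortens it by one digit
and lengthens register `12` by at most one, so the sum of the two lengths never exceeds `S`. -/
theorem yields_bits {S : ℕ} : ∀ (m : ℕ) (s : Store), s 10 = 2 → (s 11).size = m →
    (s 12).size + m ≤ S → Yields (.loop 11 bitStep) s (1 + m * (1 + 8 * (S + 1) ^ 2))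
      (randomBits m (s 12)) fun r s' => s' 12 = r ∧ r.size ≤ S ∧
        ∀ i, i ≤ 10 ∨ 15 ≤ i → s' i = s i
  | 0, s, h10, h11, h12 => by
    refine (Yields.loop_zero (Nat.size_eq_zero.1 h11) ?_).mono (by simp) fun _ _ _ h => h
    exact ⟨rfl, by omega, fun _ _ => rfl⟩
  | m + 1, s, h10, h11, h12 => by
    have h0 : s 11 ≠ 0 := by
      intro h
      simp [h] at h11
    rw [randomBits]
    have := Yields.loop_step (x := 11) (R := fun r s' => s' 12 = r ∧ r.size ≤ S ∧
        ∀ i, i ≤ 10 ∨ 15 ≤ i → s' i = s i) (T' := 1 + m * (1 + 8 * (S + 1) ^ 2))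
        (e := fun b => randomBits m (s 12 + s 12 + b.toNat)) h0
        (yields_bitStep (S := S) h10 (by omega) (by omega)) ?_
    · refine this.mono (by ring_nf; rfl) fun _ _ _ h => h
    · rintro b - s' ⟨h1, h2, h3⟩
      rw [← h2]
      refine (yields_bits m s' ?_ ?_ ?_).mono le_rfl ?_
      · rw [h3 10 (by omega), h10]
      · have := Nat.size_div_two h0
        rw [h1]; omega
      · have : (s' 12).size ≤ (s 12).size + 1 := by
          rw [Nat.size_le, h2, pow_succ]
          have h4 := (s 12).lt_size_self
          have hb : b.toNat ≤ 1 := by cases b <;> simp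
          omega
        omega
      · rintro r - s'' ⟨h4, h5, h6⟩
        exact ⟨h4, h5, fun i hi => (h6 i hi).trans (h3 i hi)⟩

/-! ### Modular exponentiation -/

/-- A step of binary exponentiation: the exponent is in register `11`, the base in register `12`,
the accumulated product in register `13`, and the modulus in register `7`. -/
def powStep : Prog :=
  .seq (.arith .mod 14 11 10) (.seq
    (.ite 14 (.seq (.arith .mul 13 13 12) (.arith .mod 13 13 7)) (.const 14 0)) (.seq
    (.arith .mul 12 12 12) (.seq (.arith .mod 12 12 7) (.arith .div 11 11 10))))

theorem straight_powStep : powStep.Straight := by simp [powStep, Prog.Straight]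

theorem time_powStep_le {s : Store} {S : ℕ} (h10 : s 10 = 2) (h7 : (s 7).size ≤ S)
    (h11 : (s 11).size ≤ S) (h12 : (s 12).size ≤ S) (h13 : (s 13).size ≤ S) :
    powStep.time s ≤ 13 * (S + 1) ^ 2 := by
  have e1 : (s 13 * s 12).size ≤ 2 * S := (Nat.size_mul_le _ _).trans (by omega)
  have e2 : (s 12 * s 12).size ≤ 2 * S := (Nat.size_mul_le _ _).trans (by omega)
  have a1 : ((s 13).size + 1) * ((s 12).size + 1) ≤ (S + 1) * (S + 1) := by gcongr
  have a2 : ((s 13 * s 12).size + 1) * ((s 7).size + 1) ≤ (2 * S + 1) * (S + 1) := by gcongr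
  have a3 : ((s 12).size + 1) * ((s 12).size + 1) ≤ (S + 1) * (S + 1) := by gcongr
  have a4 : ((s 12 * s 12).size + 1) * ((s 7).size + 1) ≤ (2 * S + 1) * (S + 1) := by gcongr
  by_cases h : s 11 % 2 = 0
  · simp [powStep, Prog.time, Prog.result, ArithOp.apply, h10, h, Nat.size_two]
    nlinarith
  · simp [powStep, Prog.time, Prog.result, ArithOp.apply, h10, h, Nat.size_two]
    nlinarith

/-- The invariant of square-and-multiply: accumulator times base to the exponent is preserved modulo
`M` by a step. -/
theorem Nat.mul_pow_div_two (a b e : ℕ) (M : ℕ) :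
    (if e % 2 = 0 then a else a * b % M) * (b * b % M) ^ (e / 2) % M = a * b ^ e % M := by
  have h1 : (b * b % M) ^ (e / 2) ≡ (b * b) ^ (e / 2) [MOD M] :=
    (Nat.mod_modEq (b * b) M).pow (e / 2)
  have he := Nat.div_add_mod e 2
  split_ifs with h
  · have h2 : b ^ e = (b * b) ^ (e / 2) := by
      conv_lhs => rw [← he, h, add_zero, pow_mul, pow_two]
    rw [h2]
    exact h1.mul_left a
  · have h2 : b ^ e = b * (b * b) ^ (e / 2) := by
      conv_lhs => rw [← he, show e % 2 = 1 by omega, pow_succ, pow_mul, pow_two, mul_comm]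
    rw [h2, ← mul_assoc]
    exact (Nat.mod_modEq (a * b) M).mul h1

/-- Reduction modulo zero is the identity and would let the numbers explode. An algorithm must halt
in time on every input, including `N = 0`; the hypothesis on `s 7` says that in this case the
exponent vanishes and the loop is not entered. The product is claimed only modulo `s 7`, since an
accumulator that is never multiplied is never reduced. -/
theorem yields_pow {S : ℕ} : ∀ (m : ℕ) (s : Store), s 10 = 2 → (s 11).size = m →
    (s 7 = 0 → m = 0) → (s 7).size ≤ S → (s 11).size ≤ S → (s 12).size ≤ S → (s 13).size ≤ S →
    Yields (.loop 11 powStep) s (1 + m * (1 + 13 * (S + 1) ^ 2)) (PMF.pure ()) fun _ s' =>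
      s' 13 % s 7 = s 13 * s 12 ^ s 11 % s 7 ∧ (s' 13).size ≤ S ∧
        ∀ i, i ≤ 10 ∨ 15 ≤ i → s' i = s i
  | 0, s, _, hm, _, _, _, _, h13 => by
    have h0 := Nat.size_eq_zero.1 hm
    exact (Yields.loop_zero h0 ⟨by simp [h0], h13, fun _ _ => rfl⟩).mono (by simp) fun _ _ _ h => h
  | m + 1, s, h10, hm, hz, h7, h11, h12, h13 => by
    have h0 : s 11 ≠ 0 := by
      intro h
      simp [h] at hm
    have hpos : 0 < s 7 := Nat.pos_of_ne_zero fun h => by simpa using hz h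
    have hmod : ∀ x, (x % s 7).size ≤ S := fun x =>
      (Nat.size_le_size (Nat.mod_lt x hpos).le).trans h7
    have := Yields.loop_step (x := 11) (R := fun _ s' =>
        s' 13 % s 7 = s 13 * s 12 ^ s 11 % s 7 ∧ (s' 13).size ≤ S ∧
        ∀ i, i ≤ 10 ∨ 15 ≤ i → s' i = s i) (T' := 1 + m * (1 + 13 * (S + 1) ^ 2))
        (e := fun _ => PMF.pure ()) h0
        (straight_powStep.yields s (time_powStep_le h10 h7 h11 h12 h13) ()) ?_
    · rw [PMF.pure_bind] at this
      refine this.mono (by ring_nf; rfl) fun _ _ _ h => h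
    · rintro - - _ rfl
      have r11 : powStep.result s 11 = s 11 / 2 := by
        by_cases h : s 11 % 2 = 0 <;>
        simp [powStep, Prog.result, ArithOp.apply, h10, h]
      have r12 : powStep.result s 12 = s 12 * s 12 % s 7 := by
        by_cases h : s 11 % 2 = 0 <;>
        simp [powStep, Prog.result, ArithOp.apply, h10, h]
      have r13 : powStep.result s 13 = if s 11 % 2 = 0 then s 13 else s 13 * s 12 % s 7 := by
        by_cases h : s 11 % 2 = 0 <;>
        simp [powStep, Prog.result, ArithOp.apply, h10, h]
      have ri : ∀ i, i ≤ 10 ∨ 15 ≤ i → powStep.result s i = s i := by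
        intro i hi
        have h1 : i ≠ 11 := by omega
        have h2 : i ≠ 12 := by omega
        have h3 : i ≠ 13 := by omega
        have h4 : i ≠ 14 := by omega
        by_cases h : s 11 % 2 = 0 <;>
        simp [powStep, Prog.result, ArithOp.apply, h10, h, h1, h2, h3, h4]
      have hsz := Nat.size_div_two h0
      refine (yields_pow m (powStep.result s) ?_ ?_ ?_ ?_ ?_ ?_ ?_).mono le_rfl ?_
      · rw [ri 10 (by omega), h10]
      · rw [r11]; omega
      · rw [ri 7 (by omega)]; intro h; omega
      · rw [ri 7 (by omega)]; exact h7
      · rw [r11]; omega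
      · rw [r12]; exact hmod _
      · rw [r13]; split_ifs
        · exact h13
        · exact hmod _
      · rintro - - s' ⟨h1, h2, h3⟩
        refine ⟨?_, h2, fun i hi => (h3 i hi).trans (ri i hi)⟩
        rw [ri 7 (by omega), r11, r12, r13, Nat.mul_pow_div_two] at h1
        exact h1

end

noncomputable section

/-! ### The query -/

/-- Prepare the generation of random bits. -/
def entryInit : Prog := .seq (.arith .mul 11 1 1) (.const 12 0)

/-- Prepare the exponentiation. -/
def powInit : Prog := .seq (.arith .mod 12 12 7) (.seq (.const 13 1) (.arith .add 11 1 8))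

/-- Reduce the residue in register `13`, and compare `i + 1` with register `5`: register `14`
becomes zero if they agree. -/
def entryCompare (i : ℕ) : Prog :=
  .seq (.arith .mod 13 13 7) (.seq (.const 14 (i + 1)) (.seq (.arith .sub 15 14 5)
    (.seq (.arith .sub 14 5 14) (.arith .add 14 14 15))))

/-- Store the entry with index `i`: register `6` if register `5` contains `i + 1`, and
the residue in register `13` otherwise. -/
def entryStore (i : ℕ) : Prog :=
  .seq (entryCompare i)
    (.ite 14 (.arith .add (23 + 2 * i) 13 8) (.arith .add (23 + 2 * i) 6 8))

/-- Generate the entry with index `i`. -/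
def entryProg (i : ℕ) : Prog :=
  .seq entryInit (.seq (.loop 11 bitStep) (.seq powInit (.seq (.loop 11 powStep) (entryStore i))))

/-- The registers hold the public key `N` with auxiliary data, the distinguished index `w` and
the entry `z` that belongs to it, all of length at most `S`. -/
structure QueryReady (S N w z : ℕ) (s : Store) : Prop where
  r1 : s 1 = N
  r5 : s 5 = w
  r6 : s 6 = z
  r7 : s 7 = N * N
  r8 : s 8 = 0
  r10 : s 10 = 2
  hN : N.size ≤ S
  hM : (N * N).size ≤ S
  hw : w.size ≤ S
  hz : z.size ≤ S

theorem QueryReady.congr {S N w z : ℕ} {s s' : Store} (h : QueryReady S N w z s)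
    (hs : ∀ i, i ≤ 10 → s' i = s i) : QueryReady S N w z s' where
  r1 := (hs 1 (by omega)).trans h.r1
  r5 := (hs 5 (by omega)).trans h.r5
  r6 := (hs 6 (by omega)).trans h.r6
  r7 := (hs 7 (by omega)).trans h.r7
  r8 := (hs 8 (by omega)).trans h.r8
  r10 := (hs 10 (by omega)).trans h.r10
  hN := h.hN
  hM := h.hM
  hw := h.hw
  hz := h.hz

theorem entryStore_time_le {S N w z i : ℕ} {s : Store} (h : QueryReady S N w z s)
    (h13 : (s 13).size ≤ S) (hi : (i + 1).size ≤ S) :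
    (entryStore i).time s ≤ 7 * (S + 1) ^ 2 := by
  have e13 : (s 13 % s 7).size ≤ S := (Nat.size_le_size (Nat.mod_le _ _)).trans h13
  have e15 : (i + 1 - w).size ≤ S := (Nat.size_le_size (Nat.sub_le _ _)).trans hi
  have e14 : (w - (i + 1)).size ≤ S := (Nat.size_le_size (Nat.sub_le _ _)).trans h.hw
  have h7 : (s 7).size ≤ S := h.r7 ▸ h.hM
  have h6 : (s 6).size ≤ S := h.r6 ▸ h.hz
  have a1 : ((s 13).size + 1) * ((s 7).size + 1) ≤ (S + 1) * (S + 1) := by gcongr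
  have a2 : ((i + 1).size + 1) * (w.size + 1) ≤ (S + 1) * (S + 1) := by gcongr; exact h.hw
  have a4 : (w.size + 1) * ((i + 1).size + 1) ≤ (S + 1) * (S + 1) := by gcongr; exact h.hw
  have a3 : ((w - (i + 1)).size + 1) * ((i + 1 - w).size + 1) ≤ (S + 1) * (S + 1) := by gcongr
  simp only [entryStore, entryCompare, Prog.time, Prog.result, Function.update_apply, ArithOp.apply, h.r5, h.r8]
  norm_num
  split_ifs <;> nlinarith

theorem entryStore_result {S N w z i : ℕ} {s : Store} (h : QueryReady S N w z s) :
    (entryStore i).result s (23 + 2 * i) = (if i + 1 = w then z else s 13 % (N * N)) ∧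
      ∀ j, j ≤ 10 ∨ (16 ≤ j ∧ j ≠ 23 + 2 * i) → (entryStore i).result s j = s j := by
  -- Subtraction is truncated, so both differences vanish only in the case of equality.
  have hc : w - (i + 1) + (i + 1 - w) = 0 ↔ i + 1 = w := by omega
  set u := (entryCompare i).result s with hu
  have u14 : u 14 = w - (i + 1) + (i + 1 - w) := by
    simp [hu, entryCompare, Prog.result, ArithOp.apply, h.r5]
  have u13 : u 13 = s 13 % (N * N) := by
    simp [hu, entryCompare, Prog.result, ArithOp.apply, h.r7]
  have uj : ∀ j, j ≤ 10 ∨ 16 ≤ j → u j = s j := by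
    intro j hj
    simp [hu, entryCompare, Prog.result, show j ≠ 13 by omega, show j ≠ 14 by omega,
      show j ≠ 15 by omega]
  have u8 : u 8 = 0 := (uj 8 (by omega)).trans h.r8
  have u6 : u 6 = z := (uj 6 (by omega)).trans h.r6
  have hr : (entryStore i).result s = if i + 1 = w then Function.update u (23 + 2 * i) z
      else Function.update u (23 + 2 * i) (s 13 % (N * N)) := by
    simp only [entryStore, Prog.result, ← hu, u14, hc, u13, u8, u6, ArithOp.apply, add_zero]
  rw [hr]
  constructor
  · split_ifs <;> simp
  · intro j hj
    rw [← uj j (by omega)]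
    split_ifs <;> exact Function.update_of_ne (by omega) _ _

/-- Random digits are consumed even if `i + 1 = w`, where the residue is discarded. The randomness
of the whole query is thus an i.i.d. vector whose law does not depend on `w`. -/
theorem yields_entryProg {S N w z i : ℕ} {s : Store} (h : QueryReady S N w z s)
    (hi : (i + 1).size ≤ S) :
    Yields (entryProg i) s (40 * (S + 1) ^ 3) (randomBits (N * N).size 0) fun r s' =>
      s' (23 + 2 * i) = (if i + 1 = w then z else r ^ N % (N * N)) ∧
        ∀ j, j ≤ 10 ∨ (16 ≤ j ∧ j ≠ 23 + 2 * i) → s' j = s j := by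
  have hN := h.hN
  have hM := h.hM
  have hS : 1 ≤ S := le_trans (Nat.size_pos.2 (Nat.succ_pos i)) hi
  have key : Yields (entryProg i) s (((S + 1) ^ 2 + 1) + ((1 + S * (1 + 8 * (S + 1) ^ 2)) +
      (((S + 1) ^ 2 + 2 + (S + 1)) + ((1 + S * (1 + 13 * (S + 1) ^ 2)) + 7 * (S + 1) ^ 2))))
      ((randomBits (N * N).size 0).bind PMF.pure) fun r s' =>
      s' (23 + 2 * i) = (if i + 1 = w then z else r ^ N % (N * N)) ∧
        ∀ j, j ≤ 10 ∨ (16 ≤ j ∧ j ≠ 23 + 2 * i) → s' j = s j := by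
    refine Yields.seq_pure (Prog.Straight.yields (by simp [entryInit, Prog.Straight]) s ?_ ()) ?_
    · simp only [entryInit, Prog.time, Nat.size_zero, h.r1]
      nlinarith
    rintro _ rfl
    have q1 : QueryReady S N w z (entryInit.result s) := h.congr fun j hj => by
      simp [entryInit, Prog.result, show j ≠ 11 by omega, show j ≠ 12 by omega]
    have b11 : entryInit.result s 11 = N * N := by
      simp [entryInit, Prog.result, ArithOp.apply, h.r1]
    have b12 : entryInit.result s 12 = 0 := by simp [entryInit, Prog.result]
    have hb := yields_bits (S := S) _ (entryInit.result s) q1.r10 rfl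
      (by rw [b11, b12, Nat.size_zero]; omega)
    rw [b11, b12] at hb
    refine Yields.seq (hb.mono (by gcongr) fun _ _ _ h => h) ?_
    rintro r - s₁ ⟨h1, hr, h2⟩
    have q2 : QueryReady S N w z s₁ := q1.congr fun j hj => h2 j (by omega)
    refine Yields.seq_pure (Prog.Straight.yields (by simp [powInit, Prog.Straight]) s₁ ?_ ()) ?_
    · simp [powInit, Prog.time, Prog.result, q2.r7, q2.r8, q2.r1, h1]
      have : (r.size + 1) * ((N * N).size + 1) ≤ (S + 1) * (S + 1) := by gcongr
      nlinarith
    rintro _ rfl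
    have q3 : QueryReady S N w z (powInit.result s₁) := q2.congr fun j hj => by
      simp [powInit, Prog.result, show j ≠ 11 by omega, show j ≠ 12 by omega,
        show j ≠ 13 by omega]
    have c11 : powInit.result s₁ 11 = N := by
      simp [powInit, Prog.result, ArithOp.apply, q2.r1, q2.r8]
    have c12 : powInit.result s₁ 12 = r % (N * N) := by
      simp [powInit, Prog.result, ArithOp.apply, q2.r7, h1]
    have c13 : powInit.result s₁ 13 = 1 := by
      simp [powInit, Prog.result, ArithOp.apply]
    have hp := yields_pow (S := S) _ (powInit.result s₁) q3.r10 rfl ?_ ?_ ?_ ?_ ?_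
    rotate_left
    -- The modulus `N * N` vanishes only together with the exponent `N`.
    · rw [q3.r7, c11]
      intro h
      simp [mul_self_eq_zero.1 h]
    · rw [q3.r7]; exact hM
    · rw [c11]; exact hN
    · rw [c12]; exact (Nat.size_le_size (Nat.mod_le _ _)).trans hr
    · rw [c13]; simpa using hS
    rw [q3.r7, c11, c12, c13] at hp
    refine Yields.seq_pure (hp.mono (by gcongr) fun _ _ _ h => h) ?_
    rintro s₂ ⟨h3, h4, h5⟩
    have q4 : QueryReady S N w z s₂ := q3.congr fun j hj => h5 j (by omega)
    refine (Prog.Straight.yields (by simp [entryStore, entryCompare, Prog.Straight]) s₂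
      (entryStore_time_le q4 h4 hi) r).mono le_rfl ?_
    rintro r' hr' _ rfl
    obtain rfl := (PMF.mem_support_pure_iff _ _).1 hr'
    obtain ⟨h6, h7⟩ := entryStore_result (i := i) q4
    constructor
    · rw [h6, h3, one_mul, Nat.pow_mod, Nat.mod_mod, ← Nat.pow_mod]
    · intro j hj
      rw [h7 j hj, h5 j (by omega)]
      have e1 : powInit.result s₁ j = s₁ j := by
        simp [powInit, Prog.result, show j ≠ 11 by omega, show j ≠ 12 by omega,
          show j ≠ 13 by omega]
      rw [e1, h2 j (by omega)]
      simp [entryInit, Prog.result, show j ≠ 11 by omega, show j ≠ 12 by omega]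
  rw [PMF.bind_pure] at key
  refine key.mono ?_ fun _ _ _ h => h
  nlinarith [Nat.zero_le (S ^ 3), Nat.zero_le (S ^ 2)]

/-- A vector of independent samples. -/
def PMF.iid {α : Type*} (d : PMF α) : (m : ℕ) → PMF (Fin m → α)
  | 0 => PMF.pure Fin.elim0
  | m + 1 => (PMF.iid d m).bind fun r => d.map fun a => Fin.snoc (α := fun _ => α) r a

/-- Generate the first `m` entries of the query. -/
def queryProg : ℕ → Prog
  | 0 => .const 11 0
  | m + 1 => .seq (queryProg m) (entryProg m)

/-- Register `23 + 2 * i` is `oddReg (i + 3)`, the place where the second phase expects entry `i`,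
after the security parameter, the key and the state. -/
theorem yields_queryProg {S N w z : ℕ} {s : Store} (h : QueryReady S N w z s) :
    ∀ m : ℕ, m ≤ S → Yields (queryProg m) s (1 + m * (40 * (S + 1) ^ 3))
      ((randomBits (N * N).size 0).iid m) fun r s' =>
        (∀ i : Fin m, s' (23 + 2 * i) = if (i : ℕ) + 1 = w then z else r i ^ N % (N * N)) ∧
        ∀ j, j ≤ 10 ∨ (16 ≤ j ∧ ∀ i < m, j ≠ 23 + 2 * i) → s' j = s j
  | 0, _ => by
    refine (yields_const _).mono (by simp) ?_
    rintro r - _ rfl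
    refine ⟨fun i => i.elim0, fun j hj => Function.update_of_ne (by omega) _ _⟩
  | m + 1, hm => by
    have hmS : (m + 1).size ≤ S := (Nat.size_le_self _).trans hm
    refine Yields.mono (T := (1 + m * (40 * (S + 1) ^ 3)) + 40 * (S + 1) ^ 3)
      (Yields.seq (yields_queryProg h m (by omega)) ?_) (by ring_nf; rfl) fun _ _ _ h => h
    rintro r - s₁ ⟨h1, h2⟩
    refine (yields_entryProg (h.congr fun j hj => h2 j (by omega)) hmS).map _ ?_
    rintro a - s' ⟨h3, h4⟩
    constructor
    · intro i
      refine Fin.lastCases ?_ (fun i => ?_) i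
      · simpa using h3
      · have hi := i.2
        simp only [Fin.val_castSucc, Fin.snoc_castSucc]
        rw [h4 _ (by omega), h1 i]
    · intro j hj
      rw [h4 j, h2 j]
      · rcases hj with hj | hj
        · exact Or.inl hj
        · exact Or.inr ⟨hj.1, fun i hi => hj.2 i (by omega)⟩
      · rcases hj with hj | hj
        · exact Or.inl hj
        · exact Or.inr ⟨hj.1, hj.2 m (by omega)⟩

end

open Polynomial

noncomputable section

/-! ### The reduction -/

/-- The registers of the first phase of a responder within the reduction. -/
def evenReg (i : ℕ) : ℕ := 2 * i + 16

/-- The registers of the second phase of a responder within the reduction. -/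
def oddReg (i : ℕ) : ℕ := 2 * i + 17

theorem evenReg_injective : evenReg.Injective := fun i j h => by
  simp only [evenReg] at h; omega

theorem oddReg_injective : oddReg.Injective := fun i j h => by
  simp only [oddReg] at h; omega

theorem notMem_range_evenReg {j : ℕ} (h : j < 16 ∨ j % 2 = 1) : j ∉ Set.range evenReg := by
  rintro ⟨i, rfl⟩
  simp only [evenReg] at h; omega

theorem notMem_range_oddReg {j : ℕ} (h : j < 17 ∨ j % 2 = 0) : j ∉ Set.range oddReg := by
  rintro ⟨i, rfl⟩
  simp only [oddReg] at h; omega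

/-- Set up the constants and the input of the first phase. -/
def proposeInit : Prog :=
  .seq (.const 9 1) (.seq (.const 10 2) (.seq (.arith .mul 7 1 1) (.seq (.arith .add 16 0 8)
    (.arith .add 18 1 8))))

/-- Select the distinguished index in accordance with the coin in register `3`, compute its entry
in accordance with the coin in register `4`, and pass the key and the state to the second phase. -/
def guessInit : Prog :=
  .seq (.ite 3 (.arith .add 5 18 8) (.arith .add 5 16 8)) (.seq (.arith .mul 6 4 1)
    (.seq (.arith .add 6 6 9) (.seq (.arith .mul 6 6 2) (.seq (.arith .mod 6 6 7)
      (.seq (.arith .add 17 0 8) (.seq (.arith .add 19 1 8) (.arith .add 21 20 8)))))))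

/-- The verdict of the reduction. -/
def verdictProg : Prog :=
  .ite 17 (.ite 3 (.arith .add 0 4 8) (.arith .sub 0 9 4))
    (.ite 3 (.arith .sub 0 9 4) (.arith .add 0 4 8))

/-- The distinguisher that is made from a responder. -/
def reductionProg {n : ℕ} (A : Responder n) : Prog :=
  .seq proposeInit (.seq (A.propose.prog.rename evenReg) (.seq (.coin 3) (.seq (.coin 4)
    (.seq guessInit (.seq (queryProg n) (.seq (A.guess.prog.rename oddReg) verdictProg))))))

/-- The query that the reduction submits, with distinguished index `w`, distinguished entry `z` and
randomness `r` for the other entries. -/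
def reductionQuery (n N w z : ℕ) (r : Fin n → ℕ) (i : Fin n) : ℕ :=
  if (i : ℕ) + 1 = w then z else r i ^ N % (N * N)

/-- The reduction as an experiment with the randomness `R` for the entries of the query. -/
def reductionWith {n : ℕ} (A : Responder n) (R : PMF (Fin n → ℕ)) (k N y : ℕ) : PMF Bool :=
  (A.propose.exec k ![N]).bind fun s =>
  (PMF.uniformOfFintype Bool).bind fun b =>
  (PMF.uniformOfFintype Bool).bind fun c =>
  R.bind fun r =>
  (A.guess.exec k (Matrix.vecCons N (Matrix.vecCons (s 2) (reductionQuery n N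
    (if b then s 1 else s 0) ((c.toNat * N + 1) * y % (N * N)) r)))).map fun s' =>
  ((decide (s' 0 ≠ 0) == b) == c)

/-- A bound on the lengths of the numbers within the reduction. -/
def reductionSize {n : ℕ} (A : Responder n) : ℕ[X] := 4 * X + A.propose.bound + C (n + 10)

/-- A bound on the running time of the reduction. -/
def reductionTime {n : ℕ} (A : Responder n) : ℕ[X] :=
  8 * (reductionSize A + 1) ^ 2 + (A.propose.bound + (1 + (1 + (12 * (reductionSize A + 1) ^ 2 +
    ((1 + C n * (40 * (reductionSize A + 1) ^ 3)) +
      (A.guess.bound.comp (C (n + 4) * (reductionSize A + 1)) + 8))))))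

/-- Natural coefficients make evaluation monotone, so time bounds may be evaluated at upper bounds
for input lengths. -/
theorem Polynomial.eval_mono_nat (p : ℕ[X]) {a b : ℕ} (h : a ≤ b) : p.eval a ≤ p.eval b := by
  rw [Polynomial.eval_eq_sum_range, Polynomial.eval_eq_sum_range]
  gcongr

theorem inputLength_one (k N : ℕ) : inputLength k ![N] = k + (N.size + 1) := by
  simp [inputLength]

theorem inputLength_two (k : ℕ) (v : Fin 2 → ℕ) :
    inputLength k v = k + ((v 0).size + 1 + ((v 1).size + 1)) := by
  simp [inputLength, Fin.sum_univ_two]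

theorem inputLength_guess_le {n k N st S : ℕ} {x : Fin n → ℕ} (hk : k ≤ S) (hN : N.size ≤ S)
    (hs : st.size ≤ S) (hx : ∀ i, (x i).size ≤ S) :
    inputLength k (Matrix.vecCons N (Matrix.vecCons st x)) ≤ (n + 4) * (S + 1) := by
  have h : ∑ i, ((x i).size + 1) ≤ n * (S + 1) := by
    refine (Finset.sum_le_card_nsmul Finset.univ _ (S + 1) fun i _ => ?_).trans (by simp)
    exact Nat.succ_le_succ (hx i)
  simp only [inputLength, Fin.sum_univ_succ, Matrix.cons_val_zero, Matrix.cons_val_succ]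
  nlinarith

theorem size_reductionQuery_le {n N w z S : ℕ} {r : Fin n → ℕ} (hz : z.size ≤ S)
    (hM : (N * N).size ≤ S) (hS : 1 ≤ S) (i : Fin n) :
    (reductionQuery n N w z r i).size ≤ S := by
  rw [reductionQuery]
  split_ifs
  · exact hz
  -- For `N = 0` nothing is reduced, but the entry is `r ^ 0 = 1`.
  · rcases Nat.eq_zero_or_pos N with rfl | h
    · simpa using hS
    · exact (Nat.size_le_size (Nat.mod_lt _ (Nat.mul_pos h h)).le).trans hM

theorem guessInit_result {k N y st w₁ w₂ : ℕ} {b c : Bool} {s : Store} (h0 : s 0 = k)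
    (h1 : s 1 = N) (h2 : s 2 = y) (h3 : s 3 = b.toNat) (h4 : s 4 = c.toNat) (h7 : s 7 = N * N)
    (h8 : s 8 = 0) (h9 : s 9 = 1) (h16 : s 16 = w₁) (h18 : s 18 = w₂) (h20 : s 20 = st) :
    guessInit.result s 5 = (if b then w₂ else w₁) ∧
    guessInit.result s 6 = (c.toNat * N + 1) * y % (N * N) ∧ guessInit.result s 17 = k ∧
    guessInit.result s 19 = N ∧ guessInit.result s 21 = st ∧
    ∀ j, j ≠ 5 → j ≠ 6 → j ≠ 17 → j ≠ 19 → j ≠ 21 → guessInit.result s j = s j := by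
  cases b <;> refine ⟨?_, ?_, ?_, ?_, ?_, fun j j5 j6 j17 j19 j21 => ?_⟩ <;>
    simp [guessInit, Prog.result, ArithOp.apply, *]

theorem guessInit_time_le {k N y st w₁ w₂ S : ℕ} {b c : Bool} {s : Store} (h0 : s 0 = k)
    (h1 : s 1 = N) (h2 : s 2 = y) (h3 : s 3 = b.toNat) (h4 : s 4 = c.toNat) (h7 : s 7 = N * N)
    (h8 : s 8 = 0) (h9 : s 9 = 1) (h16 : s 16 = w₁) (h18 : s 18 = w₂) (h20 : s 20 = st)
    (hk : k.size ≤ S) (hNy : N.size + y.size + 1 ≤ S) (hM : (N * N).size ≤ S)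
    (hw₁ : w₁.size ≤ S) (hw₂ : w₂.size ≤ S) (hst : st.size ≤ S) :
    guessInit.time s ≤ 12 * (S + 1) ^ 2 := by
  have e1 : (c.toNat * N + 1).size ≤ N.size + 1 := by
    have hc : c.toNat * N ≤ N := by cases c <;> simp
    have := Nat.size_add_le (c.toNat * N) 1
    have h' := Nat.size_le_size hc
    rw [Nat.size_one] at this
    -- The general bound for a sum gives `max N.size 1 + 1`, which is too weak only for `N = 0`.
    rcases Nat.eq_zero_or_pos N with rfl | hN
    · simp
    · have := Nat.size_pos.2 hN
      omega
  have e2 : ((c.toNat * N + 1) * y).size ≤ S := (Nat.size_mul_le _ _).trans (by omega)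
  have e3 : c.toNat.size ≤ 1 := by cases c <;> simp
  have e4 : (c.toNat * N).size ≤ S := (Nat.size_mul_le _ _).trans (by omega)
  have a1 : (c.toNat.size + 1) * (N.size + 1) ≤ 2 * (S + 1) := by gcongr <;> omega
  have a2 : ((c.toNat * N + 1).size + 1) * (y.size + 1) ≤ (S + 1) * (S + 1) := by
    gcongr <;> omega
  have a3 : (((c.toNat * N + 1) * y).size + 1) * ((N * N).size + 1) ≤ (S + 1) * (S + 1) := by
    gcongr
  have a4 : S + 1 ≤ (S + 1) * (S + 1) := Nat.le_mul_self _
  rw [pow_two]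
  cases b <;> simp [guessInit, Prog.time, Prog.result, ArithOp.apply, h0, h1, h2, h3, h4, h7, h8,
    h9, h16, h18, h20] <;> omega

/-- Correctness of the program and its time bound in one statement, for arbitrary `N` and `y`, since
the running time of an algorithm is bounded on all inputs. -/
theorem yields_reductionProg {n : ℕ} (A : Responder n) (k : ℕ) (v : Fin 2 → ℕ) :
    Yields (reductionProg A) (loadStore k v) ((reductionTime A).eval (inputLength k v))
      (reductionWith A ((randomBits (v 0 * v 0).size 0).iid n) k (v 0) (v 1))
      fun o s => decide (s 0 = 1) = o := by
  set L := inputLength k v with hL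
  set N := v 0 with hN
  set y := v 1 with hy
  set S := (reductionSize A).eval L with hS
  have hL' : L = k + (N.size + 1 + (y.size + 1)) := inputLength_two k v
  -- The term `4 * L` covers `N * N` and the product of key and challenge, the bound of the first
  -- phase covers the proposals and the state, and `n + 10` covers the indices and constants.
  have hS' : S = 4 * L + A.propose.bound.eval L + (n + 10) := by
    simp [hS, reductionSize]
  have hT : (reductionTime A).eval L = 8 * (S + 1) ^ 2 + (A.propose.bound.eval L +
      (1 + (1 + (12 * (S + 1) ^ 2 + ((1 + n * (40 * (S + 1) ^ 3)) +
        (A.guess.bound.eval ((n + 4) * (S + 1)) + 8)))))) := by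
    simp [reductionTime, hS]
  rw [hT]
  have hp : A.propose.bound.eval (inputLength k ![N]) ≤ A.propose.bound.eval L := by
    apply Polynomial.eval_mono_nat
    rw [inputLength_one]
    omega
  have hNs : (N * N).size ≤ S := (Nat.size_mul_le _ _).trans (by omega)
  have hks : k.size ≤ S := (Nat.size_le_self k).trans (by omega)
  set s₀ := loadStore k v with hs₀
  have z0 : s₀ 0 = k := rfl
  have z1 : s₀ 1 = N := rfl
  have z2 : s₀ 2 = y := rfl
  have zj : ∀ j, 3 ≤ j → s₀ j = 0 := by
    intro j hj
    obtain ⟨i, rfl⟩ := Nat.exists_eq_add_of_le' (show 1 ≤ j by omega)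
    simp [hs₀, loadStore]
    omega
  have z8 := zj 8 (by omega)
  refine Yields.seq_pure (Prog.Straight.yields (by simp [proposeInit, Prog.Straight]) s₀ ?_ ()) ?_
  · simp [proposeInit, Prog.time, Prog.result, z0, z1, z8, Nat.size_two]
    have : (N.size + 1) * (N.size + 1) ≤ (S + 1) * (S + 1) := by gcongr <;> omega
    nlinarith
  rintro _ rfl
  set u := proposeInit.result s₀ with hu
  have u16 : u 16 = k := by simp [hu, proposeInit, Prog.result, ArithOp.apply, z0, z8]
  have u18 : u 18 = N := by simp [hu, proposeInit, Prog.result, ArithOp.apply, z1, z8]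
  have u7 : u 7 = N * N := by simp [hu, proposeInit, Prog.result, ArithOp.apply, z1]
  have u9 : u 9 = 1 := by simp [hu, proposeInit, Prog.result]
  have u10 : u 10 = 2 := by simp [hu, proposeInit, Prog.result]
  have uj : ∀ j, j ≠ 7 → j ≠ 9 → j ≠ 10 → j ≠ 16 → j ≠ 18 → u j = s₀ j := by
    intro j h1 h2 h3 h4 h5
    simp [hu, proposeInit, Prog.result, h1, h2, h3, h4, h5]
  refine Yields.seq (((A.propose.yields k ![N]).rename evenReg_injective (u := u) ?_).mono hp
    fun _ _ _ h => h) ?_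
  -- The even registers from `16` on look like a fresh initial store for the first phase.
  · rintro (_ | _ | i)
    · exact u16
    · exact u18
    · rw [uj] <;> try (simp only [evenReg]; omega)
      rw [zj _ (by simp only [evenReg]; omega)]
      simp [loadStore]
  rintro s - s₁ ⟨⟨hs, hsize⟩, hfix⟩
  have hsz : ∀ i, (s i).size ≤ S := by
    intro i
    refine (hsize i).trans (max_le ?_ (hp.trans (by omega)))
    rcases i with _ | _ | i
    · exact hks
    · change N.size ≤ S
      omega
    · simp [loadStore]
  have f16 : s₁ 16 = s 0 := congrFun hs 0
  have f18 : s₁ 18 = s 1 := congrFun hs 1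
  have f20 : s₁ 20 = s 2 := congrFun hs 2
  have fj : ∀ j, j < 16 ∨ j % 2 = 1 → s₁ j = u j := fun j hj => hfix j (notMem_range_evenReg hj)
  refine Yields.seq yields_coin ?_
  rintro b - _ rfl
  refine Yields.seq yields_coin ?_
  rintro c - _ rfl
  set s₃ := Function.update (Function.update s₁ 3 b.toNat) 4 c.toNat with hs₃
  have gj : ∀ j, j ≠ 3 → j ≠ 4 → s₃ j = s₁ j := by
    intro j h3 h4
    simp [hs₃, h3, h4]
  have g0 : s₃ 0 = k := by
    rw [gj 0 (by omega) (by omega), fj 0 (by omega)]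
    exact uj 0 (by omega) (by omega) (by omega) (by omega) (by omega)
  have g1 : s₃ 1 = N := by
    rw [gj 1 (by omega) (by omega), fj 1 (by omega)]
    exact uj 1 (by omega) (by omega) (by omega) (by omega) (by omega)
  have g2 : s₃ 2 = y := by
    rw [gj 2 (by omega) (by omega), fj 2 (by omega)]
    exact uj 2 (by omega) (by omega) (by omega) (by omega) (by omega)
  have g3 : s₃ 3 = b.toNat := by simp [hs₃]
  have g4 : s₃ 4 = c.toNat := by simp [hs₃]
  have g7 : s₃ 7 = N * N := by rw [gj 7 (by omega) (by omega), fj 7 (by omega), u7]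
  have g8 : s₃ 8 = 0 := by
    rw [gj 8 (by omega) (by omega), fj 8 (by omega), ← z8]
    exact uj 8 (by omega) (by omega) (by omega) (by omega) (by omega)
  have g9 : s₃ 9 = 1 := by rw [gj 9 (by omega) (by omega), fj 9 (by omega), u9]
  have g10 : s₃ 10 = 2 := by rw [gj 10 (by omega) (by omega), fj 10 (by omega), u10]
  have g16 : s₃ 16 = s 0 := by rw [gj 16 (by omega) (by omega), f16]
  have g18 : s₃ 18 = s 1 := by rw [gj 18 (by omega) (by omega), f18]
  have g20 : s₃ 20 = s 2 := by rw [gj 20 (by omega) (by omega), f20]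
  -- The second phase expects zeros beyond its inputs, and its registers have not been touched so
  -- far.
  have godd : ∀ i, s₃ (oddReg i) = 0 := by
    intro i
    rw [gj, fj, uj, zj] <;> simp only [oddReg] <;> omega
  obtain ⟨r5, r6, r17, r19, r21, rj⟩ := guessInit_result g0 g1 g2 g3 g4 g7 g8 g9 g16 g18 g20
  refine Yields.seq_pure (Prog.Straight.yields (by simp [guessInit, Prog.Straight]) s₃
    (guessInit_time_le g0 g1 g2 g3 g4 g7 g8 g9 g16 g18 g20 hks (by omega) hNs (hsz 0) (hsz 1)
      (hsz 2)) ()) ?_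
  rintro _ rfl
  set w := if b then s 1 else s 0 with hw
  set z := (c.toNat * N + 1) * y % (N * N) with hz
  have hzs : z.size ≤ S := by
    have hc : c.toNat * N + 1 ≤ N + 1 := by cases c <;> simp
    have h1 : (N + 1).size ≤ N.size + 2 := (Nat.size_add_le N 1).trans (by
      rw [Nat.size_one]; omega)
    have h2 := Nat.size_le_size hc
    have h3 := Nat.size_mul_le (c.toNat * N + 1) y
    exact (Nat.size_le_size (Nat.mod_le _ _)).trans (by omega)
  have q : QueryReady S N w z (guessInit.result s₃) :=
    { r1 := by rw [rj _ (by omega) (by omega) (by omega) (by omega) (by omega), g1]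
      r5 := r5
      r6 := r6
      r7 := by rw [rj _ (by omega) (by omega) (by omega) (by omega) (by omega), g7]
      r8 := by rw [rj _ (by omega) (by omega) (by omega) (by omega) (by omega), g8]
      r10 := by rw [rj _ (by omega) (by omega) (by omega) (by omega) (by omega), g10]
      hN := by omega
      hM := hNs
      hw := by rw [hw]; split_ifs <;> exact hsz _
      hz := hzs }
  refine Yields.seq (yields_queryProg q n (by omega)) ?_
  rintro r - s₅ ⟨x1, x2⟩
  set vec := Matrix.vecCons N (Matrix.vecCons (s 2) (reductionQuery n N w z r)) with hvec
  have hg : A.guess.bound.eval (inputLength k vec) ≤ A.guess.bound.eval ((n + 4) * (S + 1)) := by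
    apply Polynomial.eval_mono_nat
    exact inputLength_guess_le (by omega) (by omega) (hsz 2)
      (size_reductionQuery_le hzs hNs (by omega))
  have y17 : s₅ 17 = k := by rw [x2 _ (Or.inr ⟨by omega, by omega⟩), r17]
  have y19 : s₅ 19 = N := by rw [x2 _ (Or.inr ⟨by omega, by omega⟩), r19]
  have y21 : s₅ 21 = s 2 := by rw [x2 _ (Or.inr ⟨by omega, by omega⟩), r21]
  refine Yields.seq_map (((A.guess.yields k vec).rename oddReg_injective (u := s₅) ?_).mono hg
    fun _ _ _ h => h) ?_
  · rintro (_ | _ | _ | i)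
    · exact y17
    · exact y19
    · exact y21
    · by_cases hi : i < n
      · have e := x1 ⟨i, hi⟩
        have e1 : oddReg (i + 1 + 1 + 1) = 23 + 2 * i := by simp only [oddReg]; omega
        have e2 : loadStore k vec (i + 1 + 1 + 1) = reductionQuery n N w z r ⟨i, hi⟩ := by
          rw [loadStore, dif_pos (by omega)]
          rfl
        rw [e1, e2, e]
        rfl
      · have e1 : oddReg (i + 1 + 1 + 1) = 23 + 2 * i := by simp only [oddReg]; omega
        have e2 : loadStore k vec (i + 1 + 1 + 1) = 0 := by
          simp only [loadStore]
          exact dif_neg (by omega)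
        rw [e2, ← godd (i + 1 + 1 + 1), e1,
          x2 _ (Or.inr ⟨by omega, fun j hj => by omega⟩),
          rj _ (by omega) (by omega) (by omega) (by omega) (by omega)]
  rintro s' - s₆ ⟨⟨hs', -⟩, hfix'⟩
  have h17 : s₆ 17 = s' 0 := congrFun hs' 0
  have hj : ∀ j, j ≤ 10 → j ≠ 5 → j ≠ 6 → s₆ j = s₃ j := by
    intro j h1 h2 h3
    rw [hfix' j (notMem_range_oddReg (by omega)), x2 j (Or.inl h1),
      rj j (by omega) (by omega) (by omega) (by omega) (by omega)]
  have h3 : s₆ 3 = b.toNat := (hj 3 (by omega) (by omega) (by omega)).trans g3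
  have h4 : s₆ 4 = c.toNat := (hj 4 (by omega) (by omega) (by omega)).trans g4
  have h8 : s₆ 8 = 0 := (hj 8 (by omega) (by omega) (by omega)).trans g8
  have h9 : s₆ 9 = 1 := (hj 9 (by omega) (by omega) (by omega)).trans g9
  refine Yields.mono (Prog.Straight.yields (by simp [verdictProg, Prog.Straight]) s₆ le_rfl _) ?_ ?_
  · by_cases h0 : s' 0 = 0 <;> cases b <;> cases c <;>
      simp [verdictProg, Prog.time, h17, h3, h4, h8, h9, h0]
  -- The verdict is a Boolean function of the two coins and of whether the guess is zero.
  · rintro o ho _ rfl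
    obtain rfl := (PMF.mem_support_pure_iff _ _).1 ho
    by_cases h0 : s' 0 = 0 <;> cases b <;> cases c <;>
      simp [verdictProg, Prog.result, ArithOp.apply, h17, h3, h4, h8, h9, h0]

/-- The reduction as an algorithm. -/
def reduction {n : ℕ} (A : Responder n) : PPT 2 :=
  PPT.ofYields (reductionProg A) (reductionTime A) _ _ (yields_reductionProg A)

theorem reduction_exec {n : ℕ} (A : Responder n) (k N y : ℕ) :
    ((reduction A).exec k ![N, y]).map (fun s => decide (s 0 = 1)) =
      reductionWith A ((randomBits (N * N).size 0).iid n) k N y :=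
  Yields.exec_map (A := reduction A) (yields_reductionProg A k ![N, y])

end

noncomputable section

open scoped ENNReal

/-! ### Uniform distributions -/

namespace PMF

variable {α β γ : Type*}

/-- If all fibers over `t` have `m` elements, then `s` has `m` times as many elements as `t`, and
each point of `t` receives weight `m / (m * t.card)`. Resampling, concatenation, reduction modulo
`N` and multiplication by a unit are all instances. -/
theorem map_uniformOfFinset_of_fiber [DecidableEq β] {s : Finset α} {t : Finset β} (hs : s.Nonempty)
    (ht : t.Nonempty) {f : α → β} {m : ℕ} (hf : ∀ x ∈ s, f x ∈ t)
    (hm : ∀ y ∈ t, (s.filter fun x => f x = y).card = m) :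
    (uniformOfFinset s hs).map f = uniformOfFinset t ht := by
  classical
  have hcard : s.card = t.card * m := by
    rw [Finset.card_eq_sum_card_fiberwise (f := f) (t := t) hf, Finset.sum_congr rfl hm]
    simp
  have hm0 : m ≠ 0 := by
    rintro rfl
    have := hs.card_pos
    omega
  ext y
  rw [← toOuterMeasure_apply_singleton, toOuterMeasure_map_apply,
    toOuterMeasure_uniformOfFinset_apply]
  have he : (s.filter fun x => x ∈ f ⁻¹' {y}) = s.filter fun x => f x = y := by
    ext x; simp
  rw [he]
  by_cases hy : y ∈ t
  · rw [hm y hy, uniformOfFinset_apply_of_mem ht hy, hcard]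
    push_cast
    rw [ENNReal.div_eq_inv_mul, ENNReal.mul_inv (by simp [ht.card_pos.ne']) (by simp),
      mul_assoc, ENNReal.inv_mul_cancel (by simpa using hm0) (by simp), mul_one]
  · rw [uniformOfFinset_apply_of_notMem ht hy]
    have : (s.filter fun x => f x = y) = ∅ := by
      rw [Finset.filter_eq_empty_iff]
      rintro x hx rfl
      exact hy (hf x hx)
    simp [this]

theorem uniformOfFinset_bind_map_prodMk {s : Finset α} {t : Finset β} (hs : s.Nonempty)
    (ht : t.Nonempty) :
    ((uniformOfFinset s hs).bind fun a => (uniformOfFinset t ht).map fun b => (a, b)) =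
      uniformOfFinset (s ×ˢ t) (hs.product ht) := by
  classical
  ext ⟨a, b⟩
  rw [bind_apply, tsum_eq_single a]
  · rw [map_apply, tsum_eq_single b]
    · simp only [reduceIte, uniformOfFinset_apply, Finset.mem_product, Finset.card_product]
      by_cases ha : a ∈ s <;> by_cases hb : b ∈ t <;> simp [ha, hb]
      rw [ENNReal.mul_inv (by simp) (by simp)]
    · intro b' hb'
      simp [hb'.symm]
  · intro a' ha'
    rw [mul_eq_zero]
    right
    rw [map_apply]
    simp [ha'.symm]

theorem uniformOfFinset_bind_map {s : Finset α} {t : Finset β} (hs : s.Nonempty)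
    (ht : t.Nonempty) (f : α → β → γ) :
    ((uniformOfFinset s hs).bind fun a => (uniformOfFinset t ht).map (f a)) =
      (uniformOfFinset (s ×ˢ t) (hs.product ht)).map fun x => f x.1 x.2 := by
  rw [← uniformOfFinset_bind_map_prodMk hs ht, map_bind]
  congr 1
  funext a
  rw [map_comp]
  rfl

/-- Resampling one coordinate of a uniform vector. -/
theorem uniformOfFinset_piFinset_update {ι : Type*} [Fintype ι] [DecidableEq ι] {t : Finset α}
    (ht : t.Nonempty) (i : ι) :
    ((uniformOfFinset (Fintype.piFinset fun _ : ι => t) (Fintype.piFinset_nonempty.2 fun _ => ht)).bind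
      fun r => (uniformOfFinset t ht).map fun a => Function.update r i a) =
    uniformOfFinset (Fintype.piFinset fun _ : ι => t) (Fintype.piFinset_nonempty.2 fun _ => ht) := by
  classical
  rw [uniformOfFinset_bind_map]
  refine map_uniformOfFinset_of_fiber _ _ (m := t.card) ?_ ?_
  · rintro ⟨r, a⟩ hx
    simp only [Finset.mem_product, Fintype.mem_piFinset] at hx ⊢
    intro j
    by_cases hj : j = i
    · subst hj; simpa using hx.2
    · simpa [hj] using hx.1 j
  · intro y hy
    rw [Fintype.mem_piFinset] at hy
    symm
    -- The fiber over `y` is parametrized by the value of coordinate `i` that was overwritten.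
    refine Finset.card_bij (fun b _ => (Function.update y i b, y i)) ?_ ?_ ?_
    · intro b hb
      simp only [Finset.mem_filter, Finset.mem_product, Fintype.mem_piFinset]
      refine ⟨⟨fun j => ?_, hy i⟩, by simp⟩
      by_cases hj : j = i
      · subst hj; simpa using hb
      · simpa [hj] using hy j
    · intro b _ b' _ h
      have := congrFun (congrArg Prod.fst h) i
      simpa using this
    · rintro ⟨r, a⟩ hx
      simp only [Finset.mem_filter, Finset.mem_product, Fintype.mem_piFinset] at hx
      obtain ⟨⟨hr, ha⟩, rfl⟩ := hx
      exact ⟨r i, hr i, by simp⟩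

theorem iid_uniformOfFinset {t : Finset α} (ht : t.Nonempty) (m : ℕ) :
    (uniformOfFinset t ht).iid m = uniformOfFinset (Fintype.piFinset fun _ : Fin m => t)
      (Fintype.piFinset_nonempty.2 fun _ => ht) := by
  classical
  induction m with
  | zero =>
    rw [iid]
    ext x
    rw [Subsingleton.elim x Fin.elim0, pure_apply_self, uniformOfFinset_apply_of_mem]
    · simp
    · exact Fintype.mem_piFinset.2 fun i => i.elim0
  | succ m ih =>
    rw [iid, ih, uniformOfFinset_bind_map]
    refine map_uniformOfFinset_of_fiber _ _ (m := 1) ?_ ?_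
    · rintro ⟨r, a⟩ hx
      simp only [Finset.mem_product, Fintype.mem_piFinset] at hx ⊢
      intro j
      refine Fin.lastCases ?_ (fun j => ?_) j
      · simpa using hx.2
      · simpa using hx.1 j
    · intro y hy
      rw [Fintype.mem_piFinset] at hy
      rw [Finset.card_eq_one]
      refine ⟨(Fin.init y, y (Fin.last m)), ?_⟩
      ext ⟨r, a⟩
      simp only [Finset.mem_filter, Finset.mem_product, Fintype.mem_piFinset,
        Finset.mem_singleton, Prod.mk.injEq]
      constructor
      · rintro ⟨-, rfl⟩
        simp
      · rintro ⟨rfl, rfl⟩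
        exact ⟨⟨fun j => hy _, hy _⟩, by simp⟩

theorem iid_map (d : PMF α) (f : α → β) (m : ℕ) :
    (d.map f).iid m = (d.iid m).map fun r i => f (r i) := by
  induction m with
  | zero =>
    rw [iid, iid, pure_map]
    congr 1
    exact Subsingleton.elim _ _
  | succ m ih =>
    rw [iid, iid, ih, map_bind, bind_map]
    congr 1
    funext r
    rw [Function.comp_apply, map_comp, map_comp]
    congr 1
    funext a
    funext i
    refine Fin.lastCases ?_ (fun j => ?_) i <;> simp

/-! ### Statistical distance -/

/-- The expectation of a nonnegative function. -/
def expect (p : PMF α) (f : α → ℝ≥0∞) : ℝ≥0∞ := ∑' a, p a * f a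

theorem expect_bind (p : PMF α) (g : α → PMF β) (f : β → ℝ≥0∞) :
    (p.bind g).expect f = p.expect fun a => (g a).expect f := by
  simp only [expect, bind_apply]
  simp_rw [← ENNReal.tsum_mul_right, ← ENNReal.tsum_mul_left, mul_assoc]
  exact ENNReal.tsum_comm

theorem expect_one (p : PMF α) : p.expect (fun _ => 1) = 1 := by
  simp [expect]

theorem expect_mono (p : PMF α) {f g : α → ℝ≥0∞} (h : ∀ a ∈ p.support, f a ≤ g a) :
    p.expect f ≤ p.expect g := by
  refine ENNReal.tsum_le_tsum fun a => ?_
  by_cases ha : a ∈ p.support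
  · gcongr; exact h a ha
  · simp [(p.apply_eq_zero_iff a).2 ha]

theorem expect_add (p : PMF α) (f g : α → ℝ≥0∞) :
    p.expect (fun a => f a + g a) = p.expect f + p.expect g := by
  simp only [expect, mul_add]
  exact ENNReal.tsum_add

theorem expect_const (p : PMF α) (c : ℝ≥0∞) : p.expect (fun _ => c) = c := by
  rw [expect, ENNReal.tsum_mul_right, tsum_coe, one_mul]

theorem expect_le_one (p : PMF α) {f : α → ℝ≥0∞} (h : ∀ a, f a ≤ 1) : p.expect f ≤ 1 :=
  (p.expect_mono fun a _ => h a).trans p.expect_one.le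

/-- The statistical distance of `p` and `q` is at most `δ`. -/
def StatClose (p q : PMF α) (δ : ℝ≥0∞) : Prop :=
  ∀ f : α → ℝ≥0∞, (∀ a, f a ≤ 1) → p.expect f ≤ q.expect f + δ

theorem StatClose.refl (p : PMF α) : StatClose p p 0 := fun f _ => by simp

/-- The one-sided inequality for the test `1 - f` is the reverse inequality for `f`. -/
theorem StatClose.symm {p q : PMF α} {δ : ℝ≥0∞} (h : StatClose p q δ) : StatClose q p δ := by
  intro f hf
  have h1 : ∀ r : PMF α, r.expect f + r.expect (fun a => 1 - f a) = 1 := by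
    intro r
    rw [← expect_add]
    simp_rw [add_tsub_cancel_of_le (hf _)]
    exact r.expect_one
  have h2 := h (fun a => 1 - f a) fun a => tsub_le_self
  have hfin : q.expect (fun a => 1 - f a) ≠ ∞ :=
    ne_top_of_le_ne_top ENNReal.one_ne_top (q.expect_le_one fun a => tsub_le_self)
  refine (ENNReal.add_le_add_iff_right hfin).1 ?_
  calc q.expect f + q.expect (fun a => 1 - f a) = p.expect f + p.expect (fun a => 1 - f a) := by
        rw [h1, h1]
    _ ≤ p.expect f + (q.expect (fun a => 1 - f a) + δ) := by gcongr
    _ = _ := by ring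

theorem StatClose.trans {p q r : PMF α} {δ ε : ℝ≥0∞} (h : StatClose p q δ)
    (h' : StatClose q r ε) : StatClose p r (ε + δ) := fun f hf =>
  (h f hf).trans (by rw [← add_assoc]; gcongr; exact h' f hf)

theorem StatClose.bind_left {p q : PMF α} {δ : ℝ≥0∞} (h : StatClose p q δ) (g : α → PMF β) :
    StatClose (p.bind g) (q.bind g) δ := by
  intro f hf
  rw [expect_bind, expect_bind]
  exact h _ fun a => (g a).expect_le_one hf

theorem StatClose.bind_right {p : PMF α} {g g' : α → PMF β} {δ : ℝ≥0∞}
    (h : ∀ a ∈ p.support, StatClose (g a) (g' a) δ) : StatClose (p.bind g) (p.bind g') δ := by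
  intro f hf
  rw [expect_bind, expect_bind]
  refine (p.expect_mono fun a ha => h a ha f hf).trans ?_
  rw [expect_add, expect_const]

/-- A hybrid argument: exchanging one coordinate costs `δ`. -/
theorem StatClose.iid {p q : PMF α} {δ : ℝ≥0∞} (h : StatClose p q δ) (m : ℕ) :
    StatClose (p.iid m) (q.iid m) (m * δ) := by
  induction m with
  | zero =>
    rw [Nat.cast_zero, zero_mul]
    exact StatClose.refl _
  | succ m ih =>
    rw [PMF.iid, PMF.iid]
    have h1 := StatClose.bind_right (p := p.iid m)
      (g := fun r => p.map fun a => Fin.snoc (α := fun _ => α) r a)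
      (g' := fun r => q.map fun a => Fin.snoc (α := fun _ => α) r a)
      fun r _ => h.bind_left _
    have h2 := h1.trans (ih.bind_left fun r => q.map fun a => Fin.snoc (α := fun _ => α) r a)
    convert h2 using 1
    push_cast
    ring

theorem StatClose.abs_sub_le {p q : PMF α} {δ : ℝ} (hδ : 0 ≤ δ)
    (h : StatClose p q (ENNReal.ofReal δ)) (x : α) :
    |(p x).toReal - (q x).toReal| ≤ δ := by
  classical
  have key : ∀ {p q : PMF α}, StatClose p q (ENNReal.ofReal δ) →
      (p x).toReal ≤ (q x).toReal + δ := by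
    intro p q h
    have h1 := h (fun a => if a = x then 1 else 0) fun a => by split_ifs <;> simp
    simp only [expect, mul_ite, mul_one, mul_zero, tsum_ite_eq] at h1
    have h2 := ENNReal.toReal_mono (by simp [q.apply_ne_top]) h1
    rwa [ENNReal.toReal_add (q.apply_ne_top x) (by simp), ENNReal.toReal_ofReal hδ] at h2
  have h1 := key h
  have h2 := key h.symm
  rw [abs_le]
  constructor <;> linarith

/-- A distribution that gives weight at least `c` to the elements of `t` is close to the uniform
distribution on `t`. -/
theorem statClose_uniformOfFinset {t : Finset α} (ht : t.Nonempty) {p : PMF α} {c : ℝ≥0∞}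
    (hp : ∀ a ∈ t, c ≤ p a) : StatClose (uniformOfFinset t ht) p (1 - t.card * c) := by
  classical
  intro f hf
  have h1 : ∀ r : PMF α, ∑ a ∈ t, r a * f a ≤ r.expect f := fun r => ENNReal.sum_le_tsum t
  have h2 : (uniformOfFinset t ht).expect f = ∑ a ∈ t, (t.card : ℝ≥0∞)⁻¹ * f a := by
    rw [expect, tsum_eq_sum (s := t)]
    · exact Finset.sum_congr rfl fun a ha => by rw [uniformOfFinset_apply_of_mem ht ha]
    · intro a ha
      rw [uniformOfFinset_apply_of_notMem ht ha, zero_mul]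
  have hcard : (t.card : ℝ≥0∞) ≠ 0 := by simpa using ht.card_pos.ne'
  calc (uniformOfFinset t ht).expect f = ∑ a ∈ t, (t.card : ℝ≥0∞)⁻¹ * f a := h2
    -- At each point of `t` the weight falls short of the uniform one by at most `t.card⁻¹ - c`;
    -- these deficits add up to the claimed distance.
    _ ≤ ∑ a ∈ t, (p a * f a + ((t.card : ℝ≥0∞)⁻¹ - c)) := by
        refine Finset.sum_le_sum fun a ha => ?_
        calc (t.card : ℝ≥0∞)⁻¹ * f a ≤ (c + ((t.card : ℝ≥0∞)⁻¹ - c)) * f a := by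
              gcongr
              exact le_add_tsub
          _ ≤ p a * f a + ((t.card : ℝ≥0∞)⁻¹ - c) := by
              rw [add_mul]
              gcongr
              · exact hp a ha
              · exact mul_le_of_le_one_right' (hf a)
    _ ≤ p.expect f + (1 - t.card * c) := by
        rw [Finset.sum_add_distrib]
        gcongr
        · exact h1 p
        · rw [Finset.sum_const, nsmul_eq_mul, ENNReal.mul_sub (by simp),
            ENNReal.mul_inv_cancel hcard (by simp)]

/-! ### Coins -/

/-- The one-time pad: comparison with an independent fair coin hides the law of `o`. -/
theorem coin_bind_map_beq (p : PMF Bool) :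
    ((uniformOfFintype Bool).bind fun c => p.map fun o => o == c) = uniformOfFintype Bool := by
  have h : ∀ o : Bool, ((uniformOfFintype Bool).map fun c => o == c) = uniformOfFintype Bool := by
    intro o
    ext x
    rw [map_apply, tsum_fintype, Fintype.sum_bool]
    cases o <;> cases x <;> simp
  have h1 : ∀ c, (p.map fun o => o == c) = p.bind fun o => pure (o == c) := fun c => rfl
  simp_rw [h1]
  rw [bind_comm]
  have h2 : ∀ o : Bool, ((uniformOfFintype Bool).bind fun c => pure (o == c)) =
      uniformOfFintype Bool := h
  simp_rw [h2]
  exact bind_const _ _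

end PMF

end

noncomputable section

open scoped ENNReal

/-! ### Residues -/

theorem mem_unitResidues {M x : ℕ} : x ∈ unitResidues M ↔ x < M ∧ x.Coprime M := by
  simp [unitResidues]

/-- A uniform element of `ℤ_N^*`. -/
def smallUnit (K : PaillierKey) : PMF ℕ :=
  PMF.uniformOfFinset (unitResidues K.N) (unitResidues_nonempty K.N_ne_zero)

theorem Nat.coprime_mod_iff (x M : ℕ) : (x % M).Coprime M ↔ x.Coprime M := by
  rw [Nat.Coprime, Nat.Coprime, ← Nat.gcd_rec, Nat.gcd_comm]

/-- Coprimality to `N²` depends only on the residue modulo `N`, so the fiber over `y` consists of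
the `N` numbers `y + N j` with `j < N`. -/
theorem randomUnit_map_mod (K : PaillierKey) : (randomUnit K).map (· % K.N) = smallUnit K := by
  have hN : 0 < K.N := Nat.pos_of_ne_zero K.N_ne_zero
  refine PMF.map_uniformOfFinset_of_fiber _ _ (m := K.N) ?_ ?_
  · intro x hx
    rw [mem_unitResidues] at hx ⊢
    exact ⟨Nat.mod_lt _ hN, (Nat.coprime_mod_iff _ _).2 ((Nat.coprime_pow_right_iff two_pos _ _).1 hx.2)⟩
  · intro y hy
    rw [mem_unitResidues] at hy
    conv_rhs => rw [← Finset.card_range K.N]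
    symm
    refine Finset.card_bij (fun j _ => y + K.N * j) ?_ ?_ ?_
    · intro j hj
      rw [Finset.mem_range] at hj
      rw [Finset.mem_filter, mem_unitResidues, Nat.coprime_pow_right_iff two_pos]
      refine ⟨⟨by nlinarith, ?_⟩, ?_⟩
      · simpa using hy.2
      · rw [Nat.add_mul_mod_self_left, Nat.mod_eq_of_lt hy.1]
    · intro i _ j _ h
      exact Nat.eq_of_mul_eq_mul_left hN (by omega)
    · intro x hx
      rw [Finset.mem_filter, mem_unitResidues] at hx
      refine ⟨x / K.N, ?_, ?_⟩
      · rw [Finset.mem_range]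
        exact Nat.div_lt_of_lt_mul (by rw [← pow_two]; exact hx.1.1)
      · rw [← hx.2, Nat.mod_add_div]

/-- A congruence modulo `N` lifts to one modulo `N²` between `N`-th powers. This makes an encryption
depend on its randomness modulo `N` only. -/
theorem Nat.mod_pow_self_mod_sq (r N : ℕ) : (r % N) ^ N % N ^ 2 = r ^ N % N ^ 2 := by
  have h : (N : ℤ) ∣ (r : ℤ) - ((r % N : ℕ) : ℤ) := by
    rw [Int.natCast_mod]
    exact Int.dvd_self_sub_emod
  have h2 := dvd_sub_pow_of_dvd_sub (R := ℤ) (p := N) h 1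
  rw [pow_one] at h2
  have h3 : (r % N) ^ N ≡ r ^ N [MOD N ^ 2] := by
    rw [Nat.modEq_iff_dvd]
    push_cast at h2 ⊢
    exact h2
  exact h3

/-- Random `N`-th residues are therefore fresh encryptions of zero. -/
theorem randomResidue_eq (K : PaillierKey) :
    randomResidue K = (smallUnit K).map fun r => r ^ K.N % K.N ^ 2 := by
  rw [randomResidue, ← randomUnit_map_mod, PMF.map_comp]
  congr 1
  funext y
  exact (Nat.mod_pow_self_mod_sq y K.N).symm

/-- Multiplication by a unit permutes `ℤ_{N²}^*`. -/
theorem randomUnit_map_mul (K : PaillierKey) {a : ℕ} (ha : a.Coprime K.N) :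
    (randomUnit K).map (fun y => a * y % K.N ^ 2) = randomUnit K := by
  have hM : 0 < K.N ^ 2 := pow_pos (Nat.pos_of_ne_zero K.N_ne_zero) 2
  have ha2 : a.Coprime (K.N ^ 2) := ha.pow_right 2
  have hmap : ∀ x ∈ unitResidues (K.N ^ 2), a * x % K.N ^ 2 ∈ unitResidues (K.N ^ 2) := by
    intro x hx
    rw [mem_unitResidues] at hx ⊢
    exact ⟨Nat.mod_lt _ hM, (Nat.coprime_mod_iff _ _).2 (ha2.mul_left hx.2)⟩
  have hinj : Set.InjOn (fun y => a * y % K.N ^ 2) (unitResidues (K.N ^ 2)) := by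
    intro x hx y hy h
    rw [Finset.mem_coe, mem_unitResidues] at hx hy
    have h1 : x ≡ y [MOD K.N ^ 2] := Nat.ModEq.cancel_left_of_coprime ha2.symm h
    exact Nat.ModEq.eq_of_lt_of_lt h1 hx.1 hy.1
  refine PMF.map_uniformOfFinset_of_fiber _ _ (m := 1) hmap fun y hy => ?_
  obtain ⟨x, hx, hxy⟩ := Finset.surjOn_of_injOn_of_card_le _ hmap hinj le_rfl hy
  rw [Finset.card_eq_one]
  refine ⟨x, ?_⟩
  ext x'
  rw [Finset.mem_filter, Finset.mem_singleton]
  constructor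
  · rintro ⟨hx', h⟩
    exact hinj hx' hx (h.trans hxy.symm)
  · rintro rfl
    exact ⟨hx, hxy⟩

/-! ### The quality of the sampled units -/

/-- The numbers with leading part `a` form an interval of length `2 ^ m`, which the next digit
splits into two halves. -/
theorem randomBits_apply (m a x : ℕ) : randomBits m a x =
    if a * 2 ^ m ≤ x ∧ x < (a + 1) * 2 ^ m then ((2 : ℝ≥0∞) ^ m)⁻¹ else 0 := by
  induction m generalizing a with
  | zero =>
    rw [randomBits, PMF.pure_apply]
    have : x = a ↔ a * 2 ^ 0 ≤ x ∧ x < (a + 1) * 2 ^ 0 := by omega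
    simp [this]
  | succ m ih =>
    rw [randomBits, PMF.bind_apply, tsum_fintype, Fintype.sum_bool]
    simp only [ih, PMF.uniformOfFintype_apply, Fintype.card_bool, Bool.toNat_true, Bool.toNat_false,
      add_zero]
    have hpos : 0 < 2 ^ m := by positivity
    have e0 : (a + a) * 2 ^ m = a * 2 ^ (m + 1) := by ring
    have e1 : (a + a + 1) * 2 ^ m = a * 2 ^ (m + 1) + 2 ^ m := by ring
    have e2 : (a + a + 1 + 1) * 2 ^ m = a * 2 ^ (m + 1) + 2 ^ m + 2 ^ m := by ring
    have e3 : (a + 1) * 2 ^ (m + 1) = a * 2 ^ (m + 1) + 2 ^ m + 2 ^ m := by ring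
    have e4 : ((2 : ℝ≥0∞) ^ (m + 1))⁻¹ = 2⁻¹ * (2 ^ m)⁻¹ := by
      rw [pow_succ, ENNReal.mul_inv (by simp) (by simp), mul_comm]
    rw [e0, e1, e2, e3, e4]
    generalize a * 2 ^ (m + 1) = u
    generalize 2 ^ m = t at hpos
    by_cases h1 : u ≤ x ∧ x < u + t
    · rw [if_neg (by omega), if_pos h1, if_pos (by omega)]
      simp
    · by_cases h2 : u + t ≤ x ∧ x < u + t + t
      · rw [if_pos h2, if_neg h1, if_pos (by omega)]
        simp
      · rw [if_neg h2, if_neg h1, if_neg (by omega)]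
        simp

/-- Every residue class modulo `N` has at least `⌊2 ^ m / N⌋` representatives below `2 ^ m`. -/
theorem le_randomBits_map_mod {m N x : ℕ} (hx : x < N) :
    ((2 ^ m / N : ℕ) : ℝ≥0∞) * ((2 : ℝ≥0∞) ^ m)⁻¹ ≤ (randomBits m 0).map (· % N) x := by
  classical
  rw [PMF.map_apply]
  refine le_trans ?_ (ENNReal.sum_le_tsum ((Finset.range (2 ^ m / N)).image fun j => x + N * j))
  have hN : 0 < N := by omega
  rw [Finset.sum_image]
  · refine le_of_eq ?_
    rw [Finset.sum_congr rfl (g := fun _ => ((2 : ℝ≥0∞) ^ m)⁻¹)]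
    · simp
    · intro j hj
      rw [Finset.mem_range] at hj
      rw [Nat.add_mul_mod_self_left, Nat.mod_eq_of_lt hx, if_pos rfl, randomBits_apply, if_pos]
      have h1 : N * (j + 1) ≤ N * (2 ^ m / N) := Nat.mul_le_mul_left N hj
      have h2 := Nat.mul_div_le (2 ^ m) N
      rw [mul_add] at h1
      omega
  · intro i _ j _ h
    exact Nat.eq_of_mul_eq_mul_left hN (by simpa using h)

/-- The loss has two sources: non-units make up at most `2 / 2 ^ k` of the residues, and rounding `M
/ N` down costs at most `N / M ≤ 1 / N ≤ 1 / 2 ^ k`. Then `(1 - 2 d) (1 - d) ≥ 1 - 3 d` with `d = 1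
/ 2 ^ k`. -/
theorem one_le_add_card_unitResidues {p q k : ℕ} (hp : p.Prime) (hq : q.Prime) (hpk : 2 ^ k ≤ p)
    (hqk : 2 ^ k ≤ q) {M : ℕ} (hM : (p * q) * (p * q) ≤ M) :
    (1 : ℝ) ≤ 3 / 2 ^ k + ((unitResidues (p * q)).card : ℝ) * ((M / (p * q) : ℕ) * (M : ℝ)⁻¹) := by
  have hcard : (p - 1) * (q - 1) ≤ (unitResidues (p * q)).card := by
    -- Super-multiplicativity of the totient is enough, so `p = q` need not be excluded.
    have h := Nat.totient_super_multiplicative p q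
    rw [Nat.totient_prime hp, Nat.totient_prime hq] at h
    refine h.trans (le_of_eq ?_)
    rw [Nat.totient, unitResidues]
    congr 1
    ext x
    simp [Nat.coprime_comm]
  set N := p * q with hN
  have hp1 := hp.one_lt
  have hq1 := hq.one_lt
  have hNpos : 0 < N := Nat.mul_pos hp.pos hq.pos
  have hMpos : 0 < M := lt_of_lt_of_le (Nat.mul_pos hNpos hNpos) hM
  set e : ℝ := 2 ^ k with he
  have he0 : 0 < e := by positivity
  have hpe : e ≤ p := by rw [he]; exact_mod_cast hpk
  have hqe : e ≤ q := by rw [he]; exact_mod_cast hqk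
  have hc : ((p : ℝ) - 1) * (q - 1) ≤ (unitResidues N).card := by
    have : (((p - 1) * (q - 1) : ℕ) : ℝ) ≤ (unitResidues N).card := by exact_mod_cast hcard
    rwa [Nat.cast_mul, Nat.cast_sub hp1.le, Nat.cast_sub hq1.le, Nat.cast_one] at this
  have hfl : (M : ℝ) ≤ N * (M / N : ℕ) + N := by
    have h1 := Nat.div_add_mod M N
    have h2 := Nat.mod_lt M hNpos
    have : M ≤ N * (M / N) + N := by omega
    exact_mod_cast this
  have hNr : (N : ℝ) = p * q := by rw [hN]; push_cast; ring
  have hMr : (N : ℝ) * N ≤ M := by exact_mod_cast hM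
  have hN0 : (0 : ℝ) < N := by exact_mod_cast hNpos
  have hM0 : (0 : ℝ) < M := by exact_mod_cast hMpos
  have hp0 : (1 : ℝ) < p := by exact_mod_cast hp1
  have hq0 : (1 : ℝ) < q := by exact_mod_cast hq1
  have a1 : 1 - 2 / e ≤ (unitResidues N).card / (N : ℝ) := by
    rw [le_div_iff₀ hN0]
    refine le_trans ?_ hc
    have b1 : (p : ℝ) ≤ N / e := by
      rw [le_div_iff₀ he0, hNr]
      gcongr
    have b2 : (q : ℝ) ≤ N / e := by
      rw [le_div_iff₀ he0, hNr, mul_comm]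
      gcongr
    have b3 : (1 - 2 / e) * N = N - (N / e + N / e) := by ring
    rw [b3]
    nlinarith
  have a2 : 1 - 1 / e ≤ N * ((M / N : ℕ) * (M : ℝ)⁻¹) := by
    have b1 : (N : ℝ) / M ≤ 1 / e := by
      rw [div_le_div_iff₀ hM0 he0, one_mul]
      have : e ≤ N := by rw [hNr]; nlinarith
      nlinarith
    have b2 : 1 - (N : ℝ) / M ≤ N * ((M / N : ℕ) * (M : ℝ)⁻¹) := by
      rw [← mul_assoc, ← div_eq_mul_inv, one_sub_div hM0.ne']
      gcongr
      linarith
    linarith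
  have a3 : ((unitResidues N).card : ℝ) * ((M / N : ℕ) * (M : ℝ)⁻¹) =
      (unitResidues N).card / (N : ℝ) * (N * ((M / N : ℕ) * (M : ℝ)⁻¹)) := by
    field_simp
  rw [a3]
  have c0 : 0 ≤ (unitResidues N).card / (N : ℝ) := by positivity
  have c1 : 0 ≤ N * ((M / N : ℕ) * (M : ℝ)⁻¹) := by positivity
  have e2 : 2 / e = 2 * (1 / e) := by ring
  have e3 : 3 / e = 3 * (1 / e) := by ring
  rw [e2] at a1
  rw [e3]
  have hd : 0 < 1 / e := by positivity
  generalize 1 / e = d at *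
  by_cases h3 : 1 ≤ 3 * d
  · nlinarith [mul_nonneg c0 c1]
  · nlinarith [mul_le_mul a1 a2 (by linarith) c0]

/-- The sampler never tests coprimality; the weight of the non-units is part of the deficit that is
bounded here. -/
theorem statClose_smallUnit {K : PaillierKey} {k : ℕ} (hp : 2 ^ k ≤ K.p) (hq : 2 ^ k ≤ K.q) :
    PMF.StatClose ((randomBits (K.N * K.N).size 0).map (· % K.N)) (smallUnit K)
      (ENNReal.ofReal (3 / 2 ^ k)) := by
  apply PMF.StatClose.symm
  intro f hf
  refine (PMF.statClose_uniformOfFinset (unitResidues_nonempty K.N_ne_zero)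
    (fun a ha => le_randomBits_map_mod (m := (K.N * K.N).size) (mem_unitResidues.1 ha).1) f hf).trans ?_
  gcongr
  rw [tsub_le_iff_right]
  have h := one_le_add_card_unitResidues K.prime_p K.prime_q hp hq
    (M := 2 ^ (K.N * K.N).size) (Nat.lt_size_self _).le
  have h2 := ENNReal.ofReal_le_ofReal h
  rw [ENNReal.ofReal_one, ENNReal.ofReal_add (by positivity) (by positivity),
    ENNReal.ofReal_mul (by positivity), ENNReal.ofReal_mul (by positivity),
    ENNReal.ofReal_inv_of_pos (by positivity), ENNReal.ofReal_natCast, ENNReal.ofReal_natCast,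
    ENNReal.ofReal_natCast] at h2
  push_cast at h2
  exact h2

end

noncomputable section

open scoped ENNReal

/-! ### The reduction with perfect randomness -/

/-- The randomness of a vector of encryptions. -/
def unitVector (n : ℕ) (K : PaillierKey) : PMF (Fin n → ℕ) :=
  PMF.uniformOfFinset (Fintype.piFinset fun _ : Fin n => unitResidues K.N)
    (Fintype.piFinset_nonempty.2 fun _ => unitResidues_nonempty K.N_ne_zero)

/-- The event that the second phase guesses the second proposal. -/
def guessBit {n : ℕ} (A : Responder n) (k N st : ℕ) (x : Fin n → ℕ) : PMF Bool :=
  (A.guess.exec k (Matrix.vecCons N (Matrix.vecCons st x))).map fun s' => decide (s' 0 ≠ 0)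

theorem reductionWith_eq {n : ℕ} (A : Responder n) (R : PMF (Fin n → ℕ)) (k N y : ℕ) :
    reductionWith A R k N y = (A.propose.exec k ![N]).bind fun s =>
      (PMF.uniformOfFintype Bool).bind fun b => (PMF.uniformOfFintype Bool).bind fun c =>
      (R.bind fun r => (guessBit A k N (s 2) (reductionQuery n N (if b then s 1 else s 0)
        ((c.toNat * N + 1) * y % N ^ 2) r)).map fun g => g == b).map fun o => o == c := by
  simp only [reductionWith, guessBit, PMF.map_bind, PMF.map_comp, Function.comp_def, pow_two]

theorem reductionWith_map_mod {n : ℕ} (A : Responder n) (R : PMF (Fin n → ℕ)) (k N y : ℕ) :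
    reductionWith A (R.map fun r i => r i % N) k N y = reductionWith A R k N y := by
  have h : ∀ w z r, reductionQuery n N w z (fun i => r i % N) = reductionQuery n N w z r := by
    intro w z r
    funext i
    simp only [reductionQuery, ← pow_two, Nat.mod_pow_self_mod_sq]
  simp only [reductionWith_eq, PMF.bind_map, Function.comp_def, h]

theorem PMF.StatClose.reductionWith {n : ℕ} (A : Responder n) {R R' : PMF (Fin n → ℕ)} {δ : ℝ≥0∞}
    (h : PMF.StatClose R R' δ) (k N y : ℕ) :
    PMF.StatClose (reductionWith A R k N y) (reductionWith A R' k N y) δ :=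
  .bind_right fun _ _ => .bind_right fun _ _ => .bind_right fun _ _ => h.bind_left _

/-- On a uniform challenge the verdict of the reduction is a fair coin. -/
theorem randomUnit_bind_reductionWith {n : ℕ} (A : Responder n) (R : PMF (Fin n → ℕ)) (k : ℕ)
    (K : PaillierKey) : ((randomUnit K).bind fun y => reductionWith A R k K.N y) =
      PMF.uniformOfFintype Bool := by
  simp only [reductionWith_eq]
  rw [PMF.bind_comm]
  refine Eq.trans (congrArg _ (funext fun s => ?_)) (PMF.bind_const _ _)
  rw [PMF.bind_comm]
  refine Eq.trans (congrArg _ (funext fun b => ?_)) (PMF.bind_const _ _)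
  rw [PMF.bind_comm]
  set F : ℕ → PMF Bool := fun z => R.bind fun r => (guessBit A k K.N (s 2)
    (reductionQuery n K.N (if b then s 1 else s 0) z r)).map fun g => g == b with hF
  -- Since `cN + 1` is coprime to `N`, the distinguished entry is uniform for either value of `c`;
  -- after that `c` only pads the outcome.
  have h : ∀ c : Bool, ((randomUnit K).bind fun y =>
      (F ((c.toNat * K.N + 1) * y % K.N ^ 2)).map fun o => o == c) =
      ((randomUnit K).bind F).map fun o => o == c := by
    intro c
    conv_rhs => rw [← randomUnit_map_mul K (a := c.toNat * K.N + 1) (by simp)]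
    rw [PMF.bind_map, PMF.map_bind]
    rfl
  simp only [hF] at h
  simp only [h]
  exact PMF.coin_bind_map_beq _

/-- Encryptions of the bit `t` at index `w` and of zero at the other indices. -/
def bitQuery (n : ℕ) (K : PaillierKey) (t w : ℕ) : PMF (Fin n → ℕ) :=
  (unitVector n K).map fun r i => paillierEncrypt K.N (if (i : ℕ) + 1 = w then t else 0) (r i)

/-- With `y = r ^ N`, the entry `(cN + 1) y` is `E(c; r)`, because `(N + 1) ^ c = cN + 1` for a bit
`c`. Its randomness `r` replaces that of coordinate `w - 1` in a uniform vector, which leaves the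
vector uniform. -/
theorem residue_bind_reductionQuery {n : ℕ} (K : PaillierKey) {w : ℕ} (hw : w ∈ Finset.Icc 1 n)
    (c : Bool) : ((randomResidue K).bind fun y => (unitVector n K).map
      (reductionQuery n K.N w ((c.toNat * K.N + 1) * y % K.N ^ 2))) = bitQuery n K c.toNat w := by
  rw [Finset.mem_Icc] at hw
  let i₀ : Fin n := ⟨w - 1, by omega⟩
  conv_rhs => rw [bitQuery, unitVector, ← PMF.uniformOfFinset_piFinset_update
    (unitResidues_nonempty K.N_ne_zero) i₀, PMF.map_bind]
  rw [randomResidue_eq, PMF.bind_map]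
  simp only [Function.comp_def, PMF.map_comp]
  simp only [PMF.map, Function.comp_def]
  rw [PMF.bind_comm]
  congr 1
  funext r
  congr 1
  funext a
  congr 1
  funext i
  simp only [reductionQuery, paillierEncrypt]
  by_cases hi : (i : ℕ) + 1 = w
  · have : i = i₀ := Fin.ext (by simp only [i₀]; omega)
    subst this
    rw [if_pos hi, if_pos hi, Function.update_self, Nat.mul_mod_mod]
    cases c <;> simp
  · have : i ≠ i₀ := by
      rintro rfl
      simp only [i₀] at hi
      omega
    rw [if_neg hi, if_neg hi, Function.update_of_ne this, pow_zero, one_mul, pow_two]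

/-- The security experiment for a given key. -/
def keyExperiment {n : ℕ} (A : Responder n) (k : ℕ) (K : PaillierKey) : PMF Bool :=
  (A.propose.exec k ![K.N]).bind fun s => (PMF.uniformOfFintype Bool).bind fun b =>
    (submitQuery n K (if b then s 1 else s 0)).bind fun x =>
    (A.guess.exec k (Matrix.vecCons K.N (Matrix.vecCons (s 2) x))).map fun s' =>
    decide ((if s' 0 = 0 then s 0 else s 1) = if b then s 1 else s 0)

/-- On a residue as challenge, the reduction runs the security experiment if the second coin shows
`true`, and otherwise its verdict is a fair coin. -/
theorem randomResidue_bind_reductionWith {n : ℕ} (A : Responder n) (k : ℕ) (K : PaillierKey)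
    (hA : ∀ s ∈ (A.propose.exec k ![K.N]).support,
      s 0 ∈ Finset.Icc 1 n ∧ s 1 ∈ Finset.Icc 1 n ∧ s 0 ≠ s 1) :
    ((randomResidue K).bind fun y => reductionWith A (unitVector n K) k K.N y) =
      (PMF.uniformOfFintype Bool).bind fun c =>
        if c then keyExperiment A k K else PMF.uniformOfFintype Bool := by
  simp only [reductionWith_eq]
  rw [PMF.bind_comm]
  have h1 : ∀ s ∈ (A.propose.exec k ![K.N]).support, ((randomResidue K).bind fun y =>
      (PMF.uniformOfFintype Bool).bind fun b => (PMF.uniformOfFintype Bool).bind fun c =>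
      ((unitVector n K).bind fun r => (guessBit A k K.N (s 2) (reductionQuery n K.N
        (if b then s 1 else s 0) ((c.toNat * K.N + 1) * y % K.N ^ 2) r)).map
          fun g => g == b).map fun o => o == c) =
      (PMF.uniformOfFintype Bool).bind fun c => (PMF.uniformOfFintype Bool).bind fun b =>
        ((bitQuery n K c.toNat (if b then s 1 else s 0)).bind fun x =>
          (guessBit A k K.N (s 2) x).map fun g => g == b).map fun o => o == c := by
    intro s hs
    obtain ⟨h0, h1, -⟩ := hA s hs
    rw [PMF.bind_comm]
    rw [PMF.bind_comm (PMF.uniformOfFintype Bool) (PMF.uniformOfFintype Bool)]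
    congr 1
    funext b
    rw [PMF.bind_comm]
    congr 1
    funext c
    rw [← residue_bind_reductionQuery K (show (if b then s 1 else s 0) ∈ Finset.Icc 1 n by
      split_ifs <;> assumption) c]
    simp only [PMF.map_bind, PMF.bind_bind, PMF.bind_map, Function.comp_def]
  rw [PMF.bind_congr_of_support h1, PMF.bind_comm]
  congr 1
  funext c
  cases c
  · rw [if_neg (by simp)]
    refine Eq.trans (congrArg _ (funext fun s => ?_)) (PMF.bind_const _ _)
    -- All entries encrypt zero, so the query is the same for both proposals and `b` is independent
    -- of the guess.
    have h2 : ∀ w, bitQuery n K (Bool.toNat false) w = bitQuery n K 0 0 := by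
      intro w
      simp only [bitQuery, Bool.toNat_false, ite_self]
    simp only [h2]
    have h3 : ∀ b, ((bitQuery n K 0 0).bind fun x =>
        (guessBit A k K.N (s 2) x).map fun g => g == b) =
        ((bitQuery n K 0 0).bind fun x => guessBit A k K.N (s 2) x).map fun g => g == b := by
      intro b
      rw [PMF.map_bind]
    simp only [h3]
    rw [← PMF.map_bind, PMF.coin_bind_map_beq]
    ext x
    rw [PMF.map_apply, tsum_fintype, Fintype.sum_bool]
    cases x <;> simp
  · rw [if_pos rfl, keyExperiment]
    refine PMF.bind_congr_of_support fun s hs => ?_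
    obtain ⟨-, -, hne⟩ := hA s hs
    congr 1
    funext b
    have h2 : ∀ w, bitQuery n K (Bool.toNat true) w = submitQuery n K w := fun w => rfl
    rw [h2, PMF.map_bind]
    congr 1
    funext x
    rw [guessBit, PMF.map_comp, PMF.map_comp]
    congr 1
    funext s'
    -- As the proposals differ, the guess agrees with `b` exactly when `w' = w`.
    by_cases h0 : s' 0 = 0 <;> cases b <;> simp [h0, hne, hne.symm]

theorem guessExperiment_eq {n : ℕ} (G : KeyGen) (A : Responder n) (k : ℕ) :
    guessExperiment G A k = (G.dist k).bind (keyExperiment A k) := rfl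

/-! ### The advantage of the reduction -/

/-- The probability that the reduction accepts if it has perfect randomness. -/
def idealProb {n : ℕ} (G : KeyGen) (X : PaillierKey → PMF ℕ) (A : Responder n) (k : ℕ) : ℝ :=
  (((G.dist k).bind fun K => (X K).bind fun y =>
    reductionWith A (unitVector n K) k K.N y) true).toReal

theorem coin_toReal : (PMF.uniformOfFintype Bool true).toReal = 1 / 2 := by
  simp

theorem idealProb_randomUnit {n : ℕ} (G : KeyGen) (A : Responder n) (k : ℕ) :
    idealProb G randomUnit A k = 1 / 2 := by
  simp only [idealProb, randomUnit_bind_reductionWith, PMF.bind_const]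
  exact coin_toReal

/-- The average over `c` of the success probability of the responder and of `1 / 2`. -/
theorem idealProb_randomResidue {n : ℕ} (G : KeyGen) (A : Responder n) (hA : A.Admissible G)
    (k : ℕ) : idealProb G randomResidue A k =
      ((guessExperiment G A k true).toReal + 1 / 2) / 2 := by
  rw [idealProb, PMF.bind_congr_of_support
    fun K hK => randomResidue_bind_reductionWith A k K (hA k K hK), PMF.bind_comm,
    PMF.bind_apply, tsum_fintype, Fintype.sum_bool, guessExperiment_eq]
  simp only [PMF.uniformOfFintype_apply, Fintype.card_bool, if_true, Bool.false_eq_true, if_false,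
    PMF.bind_const]
  have h := PMF.apply_ne_top ((G.dist k).bind (keyExperiment A k)) true
  rw [ENNReal.toReal_add (ENNReal.mul_ne_top (by simp) h) (by simp [ENNReal.mul_eq_top]),
    ENNReal.toReal_mul, ENNReal.toReal_mul]
  simp
  ring

theorem abs_acceptProb_sub_idealProb_le {n : ℕ} (G : KeyGen) (X : PaillierKey → PMF ℕ)
    (A : Responder n) (k : ℕ) :
    |acceptProb G X (reduction A) k - idealProb G X A k| ≤ n * (3 / 2 ^ k) := by
  rw [acceptProb, idealProb]
  refine PMF.StatClose.abs_sub_le (by positivity) ?_ true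
  refine .bind_right fun K hK => .bind_right fun y _ => ?_
  -- The random numbers may be reduced modulo `N` without effect on the query. Only then are they
  -- comparable with uniform units, coordinate by coordinate.
  rw [reduction_exec, ← reductionWith_map_mod, ← PMF.iid_map _ (· % K.N),
    ENNReal.ofReal_mul (by positivity), ENNReal.ofReal_natCast, unitVector,
    ← PMF.iid_uniformOfFinset (unitResidues_nonempty K.N_ne_zero)]
  obtain ⟨hp, hq⟩ := G.large k K hK
  exact ((statClose_smallUnit hp hq).iid n).reductionWith A k K.N y

/-- With perfect randomness the acceptance probabilities differ by half of the signed advantage.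
Each of the two is off by at most `3 n / 2 ^ k`, and doubling gives `12 n / 2 ^ k`. -/
theorem advantage_le {n : ℕ} (G : KeyGen) (A : Responder n) (hA : A.Admissible G) (k : ℕ) :
    advantage G A k ≤ 2 * |acceptProb G randomResidue (reduction A) k -
      acceptProb G randomUnit (reduction A) k| + 12 * n * (1 / 2 ^ k) := by
  have h1 := abs_acceptProb_sub_idealProb_le G randomResidue A k
  have h2 := abs_acceptProb_sub_idealProb_le G randomUnit A k
  rw [idealProb_randomResidue G A hA] at h1
  rw [idealProb_randomUnit] at h2
  have h3 : (n : ℝ) * (3 / 2 ^ k) = 3 * (n * (1 / 2 ^ k)) := by ring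
  have h4 : 12 * (n : ℝ) * (1 / 2 ^ k) = 12 * (n * (1 / 2 ^ k)) := by ring
  rw [advantage, h4]
  rw [h3] at h1 h2
  generalize acceptProb G randomResidue (reduction A) k = a at *
  generalize acceptProb G randomUnit (reduction A) k = b at *
  generalize (guessExperiment G A k true).toReal = W at *
  rw [abs_le] at h1 h2
  have h5 := le_abs_self (a - b)
  have h6 := neg_abs_le (a - b)
  rw [abs_le]
  constructor <;> linarith [h1.1, h1.2, h2.1, h2.2]

/-! ### Negligible functions -/

theorem Negligible.mono {f g : ℕ → ℝ} (hg : Negligible g) (h : ∀ n, f n ≤ g n) : Negligible f :=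
  fun c => (hg c).imp fun _ hn n hle => (h n).trans (hn n hle)

theorem Negligible.add {f g : ℕ → ℝ} (hf : Negligible f) (hg : Negligible g) :
    Negligible fun n => f n + g n := by
  intro c
  obtain ⟨n₁, h₁⟩ := hf (c + 1)
  obtain ⟨n₂, h₂⟩ := hg (c + 1)
  -- Both summands are bounded with exponent `c + 1`; for `n ≥ 2` the additional factor `1 / n`
  -- absorbs the factor two.
  refine ⟨max 2 (max n₁ n₂), fun n hn => ?_⟩
  have a1 := h₁ n (by omega)
  have a2 := h₂ n (by omega)
  have hn2 : (2 : ℝ) ≤ n := by exact_mod_cast (show 2 ≤ n by omega)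
  have h0 : (0 : ℝ) < n := by linarith
  have h3 : 1 / (n : ℝ) ^ (c + 1) ≤ 1 / (n : ℝ) ^ c / 2 := by
    rw [div_div, pow_succ]
    gcongr
  linarith

theorem Negligible.const_mul {f : ℕ → ℝ} (hf : Negligible f) (m : ℕ) :
    Negligible fun n => m * f n := by
  induction m with
  | zero => exact fun c => ⟨0, fun n _ => by simp⟩
  | succ m ih => exact (ih.add hf).mono fun n => le_of_eq (by push_cast; ring)

theorem negligible_inv_two_pow : Negligible fun n => 1 / 2 ^ n := by
  intro c
  have h := tendsto_pow_const_div_const_pow_of_one_lt c (r := (2 : ℝ)) (by norm_num)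
  have h1 := (h.eventually (gt_mem_nhds (show (0 : ℝ) < 1 by norm_num))).and
    (Filter.eventually_ge_atTop 1)
  obtain ⟨n₀, hn₀⟩ := Filter.eventually_atTop.1 h1
  refine ⟨n₀, fun n hn => ?_⟩
  obtain ⟨a1, a2⟩ := hn₀ n hn
  have hn0 : (0 : ℝ) < n := by exact_mod_cast a2
  rw [div_lt_one (by positivity)] at a1
  exact one_div_le_one_div_of_le (by positivity) a1.le

end

theorem proposition3 (n : ℕ) (G : KeyGen) (hG : DecisionalCompositeResiduosity G) :
    QuerySecure n G := by
  intro A hA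
  refine (((hG (reduction A)).const_mul 2).add (negligible_inv_two_pow.const_mul (12 * n))).mono
    fun k => ?_
  have h := advantage_le G A hA k
  push_cast
  exact h
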